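/- Let $X$ be a smooth $n$-dimensional manifold (without boundary; compactness is not needed) oriented by a smooth volume form $\Omega>0$, and let $\mathcal M$ be the set of smooth Riemannian metrics on $X$. Let $K\in C^\infty(X,\mathrm{End}(T_X))$ be a smooth field of endomorphisms which has $n$ distinct real eigenvalues at every point of a dense subset of $X$ (for instance everywhere, or almost everywhere). For $g\in\mathcal M$ let $\nabla_g$ be the Levi-Civita connection, $\mathcal R_g(\xi,\eta)\in\mathrm{End}(T_X)$ the Riemann curvature, and for a symmetric $2$-tensor $v$ let $v_g^*:=g^{-1}v\in \mathrm{End}(T_X)$ be the endomorphism with $g(v_g^*\xi,\eta)=v(\xi,\eta)$. Let $\mathbb F^K_g$ be the vector space of all $v\in C^\infty(X,S^2_{\mathbb R}T_X^*)$ such that $$(\nabla_{g,\xi}v_g^*)\,\eta=(\nabla_{g,\eta}v_g^*)\,\xi\qquad\text{for all tangent vectors }\xi,\eta$$ (that is, the covariant exterior derivative of the $T_X$-valued $1$-form $v_g^*$ vanishes) and such that, for all integers $p\ge 0$, all $\xi\in T_X^{\otimes p}$ and all tangent vectors $u,w$, $$[K,\nabla^p_{g,\xi}v_g^*]=0,\qquad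 [\mathcal R_g(u,w),\nabla^p_{g,\xi}v_g^*]=0 .$$ Let $$\mathrm{Ric}_g(\Omega):=\mathrm{Ric}(g)+\nabla_g\,d\log\frac{dV_g}{\Omega},\qquad \mathcal S^K_\Omega:=\{g\in\mathcal M\mid \mathrm{Ric}_g(\Omega)\in\mathbb F^K_g\}.$$ Let $(g_t)_{t\in\mathbb R}\subset\mathcal M$ be a smooth family of metrics (smooth in $(t,x)\in\mathbb R\times X$) such that $\dot g_t\in\mathbb F^K_{g_t}$ for all $t\in\mathbb R$. If $g_0\in\mathcal S^K_\Omega$, then $g_t\in\mathcal S^K_\Omega$ for all $t\in\mathbb R$. -/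

import Mathlib

open Set Manifold
open scoped ContDiff

noncomputable section

namespace ScatteringData

/-! ## Riemannian geometry in a coordinate domain

`E` is the coordinate space `ℝⁿ`.  A metric is given by its coordinate expression
`g : E → Bil E`, and `y : E` is the point at which a tensor is evaluated. -/

section Local

variable {E : Type*} [NormedAddCommGroup E] [NormedSpace ℝ E]

/-- Continuous bilinear forms: the values of coordinate expressions of covariant `2`-tensors. -/
abbrev Bil (E : Type*) [NormedAddCommGroup E] [NormedSpace ℝ E] : Type _ := E →L[ℝ] E →L[ℝ] ℝ

/-- The endomorphism `v* = b⁻¹ v` determined by `b (v* ξ, η) = v (ξ, η)`, where `b` is a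
non-degenerate bilinear form, seen as a linear map from `E` to its dual. -/
def raise (b v : Bil E) : E →L[ℝ] E := (ContinuousLinearMap.inverse b) ∘L v

/-- The Christoffel symbols of the first kind: the bilinear form
`(v, w) ↦ (1/2) (∂ᵤ g (v, w) + ∂ᵥ g (u, w) - ∂_w g (u, v))`. -/
def christoffelLower (g : E → Bil E) (y u : E) : Bil E :=
  (1 / 2 : ℝ) • (fderiv ℝ g y u + (fderiv ℝ g y).flip u - ((fderiv ℝ g y).flip u).flip)

theorem christoffelLower_apply (g : E → Bil E) (y u v w : E) :
    christoffelLower g y u v w =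
      (1 / 2) * (fderiv ℝ g y u v w + fderiv ℝ g y v u w - fderiv ℝ g y w u v) := by
  simp [christoffelLower]

/-- The Christoffel symbols `Γ (u, v)` of the Levi-Civita connection of `g`:
`∇ᵤ v = ∂ᵤ v + Γ (u, v)`. -/
def christoffel (g : E → Bil E) (y u : E) : E →L[ℝ] E := raise (g y) (christoffelLower g y u)

theorem christoffel_add (g : E → Bil E) (y u u' : E) :
    christoffel g y (u + u') = christoffel g y u + christoffel g y u' := by
  ext v
  simp only [christoffel, raise, ContinuousLinearMap.comp_apply, add_apply,
    ← map_add]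
  congr 1
  ext w
  simp [christoffelLower_apply]
  ring

theorem christoffel_smul (g : E → Bil E) (y : E) (a : ℝ) (u : E) :
    christoffel g y (a • u) = a • christoffel g y u := by
  ext v
  simp only [christoffel, raise, ContinuousLinearMap.comp_apply, smul_apply,
    ← map_smul]
  congr 1
  ext w
  simp [christoffelLower_apply]
  ring

/-- The Riemann curvature `R (u, v) = ∇ᵤ ∇ᵥ - ∇ᵥ ∇ᵤ - ∇_[u, v]`, an endomorphism. -/
def curvature (g : E → Bil E) (y u v : E) : E →L[ℝ] E :=
  fderiv ℝ (fun z => christoffel g z v) y u - fderiv ℝ (fun z => christoffel g z u) y v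
    + (christoffel g y u ∘L christoffel g y v - christoffel g y v ∘L christoffel g y u)

/-- The covariant derivative of a field `A` of `End`-valued covariant `p`-tensors:
`(∇A) (ξ₀, …, ξ_p) = ∂_{ξ₀} A (ξ₁, …, ξ_p) + [Γ (ξ₀, ·), A (ξ₁, …, ξ_p)]
  - ∑ᵢ A (ξ₁, …, Γ (ξ₀, ξᵢ), …, ξ_p)`. -/
def covDeriv {p : ℕ} (g : E → Bil E) (A : E → (Fin p → E) → (E →L[ℝ] E))
    (y : E) (ξ : Fin (p + 1) → E) : E →L[ℝ] E :=
  fderiv ℝ (fun z => A z (Fin.tail ξ)) y (ξ 0)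
    + (christoffel g y (ξ 0) ∘L A y (Fin.tail ξ) - A y (Fin.tail ξ) ∘L christoffel g y (ξ 0))
    - ∑ i : Fin p, A y (Function.update (Fin.tail ξ) i (christoffel g y (ξ 0) (ξ i.succ)))

/-- The `p`-th covariant derivative `∇ᵖ_{ξ₁, …, ξ_p} H` of a field of endomorphisms; the
newest derivative is in the first slot. -/
def iterCovDeriv (g : E → Bil E) (H : E → (E →L[ℝ] E)) :
    (p : ℕ) → E → (Fin p → E) → (E →L[ℝ] E)
  | 0 => fun y _ => H y
  | p + 1 => covDeriv g (iterCovDeriv g H p)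

variable [FiniteDimensional ℝ E]

/-- The bilinear form `(v, w) ↦ B v w`, assembled from the values of `B` (which is meant to be
linear in `v`) on the fixed basis of `E`. -/
def bilOf (B : E → (E →L[ℝ] ℝ)) : Bil E :=
  ∑ j, (LinearMap.toContinuousLinearMap ((Module.finBasis ℝ E).coord j)).smulRight
    (B (Module.finBasis ℝ E j))

theorem bilOf_apply (B : E → (E →L[ℝ] ℝ)) (hadd : ∀ u v, B (u + v) = B u + B v)
    (hsmul : ∀ (a : ℝ) u, B (a • u) = a • B u) (v : E) : bilOf B v = B v := by
  let L : E →ₗ[ℝ] (E →L[ℝ] ℝ) := ⟨⟨B, hadd⟩, hsmul⟩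
  have h : L (∑ j, (Module.finBasis ℝ E).repr v j • Module.finBasis ℝ E j) = L v := by
    rw [(Module.finBasis ℝ E).sum_repr]
  rw [map_sum] at h
  simp only [map_smul] at h
  change _ = L v
  rw [← h]
  ext w
  simp [bilOf, L]

/-- The Ricci tensor `Ric (v, w) = Tr (u ↦ R (u, v) w)`. -/
def ricci (g : E → Bil E) (y : E) : Bil E :=
  bilOf fun v => ∑ i, (LinearMap.toContinuousLinearMap ((Module.finBasis ℝ E).coord i)) ∘L
    curvature g y (Module.finBasis ℝ E i) v

theorem ricci_apply (g : E → Bil E) (y : E)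
    (hΓ : ∀ u, DifferentiableAt ℝ (fun z => christoffel g z u) y) (v w : E)
    (R : E →ₗ[ℝ] E) (hR : ∀ u, R u = curvature g y u v w) :
    ricci g y v w = LinearMap.trace ℝ E R := by
  rw [ricci, bilOf_apply, LinearMap.trace_eq_matrix_trace ℝ (Module.finBasis ℝ E), Matrix.trace]
  · simp [LinearMap.toMatrix_apply, hR]
  · intro u v
    rw [← Finset.sum_add_distrib]
    refine Finset.sum_congr rfl fun i _ => ?_
    ext w
    simp only [curvature, christoffel_add, fderiv_fun_add (hΓ u) (hΓ v)]
    simp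
    ring
  · intro a v
    rw [Finset.smul_sum]
    refine Finset.sum_congr rfl fun i _ => ?_
    ext w
    simp only [curvature, christoffel_smul, fderiv_fun_const_smul (hΓ v)]
    simp
    ring

/-- The Hessian `(∇ df) (u, v) = ∂ᵤ∂ᵥ f - df (Γ (u, v))` of a function. -/
def hessian (g : E → Bil E) (f : E → ℝ) (y : E) : Bil E :=
  bilOf fun u => fderiv ℝ (fderiv ℝ f) y u - fderiv ℝ f y ∘L christoffel g y u

theorem hessian_apply (g : E → Bil E) (f : E → ℝ) (y u v : E) :
    hessian g f y u v = fderiv ℝ (fderiv ℝ f) y u v - fderiv ℝ f y (christoffel g y u v) := by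
  rw [hessian, bilOf_apply]
  · simp
  · intro u v
    ext w
    simp [christoffel_add]
    ring
  · intro a u
    ext w
    simp [christoffel_smul]
    ring

/-- `log (dV_g / Ω)`, where `(∂ᵢ)` is the fixed basis of the coordinate space `E` and
`vol = Ω (∂₁, …, ∂ₙ)`.  As the manifold is oriented by `Ω`, the Riemannian volume form is
`dV_g (∂₁, …, ∂ₙ) = sign vol * √(det (g (∂ᵢ, ∂ⱼ)))`. -/
def logVolRatio (g : E → Bil E) (vol : E → ℝ) (y : E) : ℝ :=
  Real.log (Real.sqrt (Matrix.of fun i j =>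
    g y (Module.finBasis ℝ E i) (Module.finBasis ℝ E j)).det / |vol y|)

/-- The `Ω`-Bakry-Emery-Ricci tensor `Ric_g (Ω) = Ric g + ∇ d log (dV_g / Ω)`. -/
def bakryEmeryRicci (g : E → Bil E) (vol : E → ℝ) (y : E) : Bil E :=
  ricci g y + hessian g (logVolRatio g vol) y

end Local

/-! ## Coordinate expressions of the objects on a manifold -/

section Global

variable (E : Type*) [NormedAddCommGroup E] [NormedSpace ℝ E]
variable {X : Type*} [TopologicalSpace X] [ChartedSpace E X]

/-- The (open) coordinate domain of the chart around `c`. -/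
abbrev coordDomain (c : X) : Set E := (extChartAt 𝓘(ℝ, E) c).target

variable {E}

/-- The point with coordinates `y` in the chart around `c`. -/
abbrev pt (c : X) (y : E) : X := (extChartAt 𝓘(ℝ, E) c).symm y

/-- Tangent spaces of the manifold. -/
abbrev T (E : Type*) [NormedAddCommGroup E] [NormedSpace ℝ E] {X : Type*} [TopologicalSpace X]
    [ChartedSpace E X] (x : X) : Type _ := TangentSpace 𝓘(ℝ, E) x

variable [IsManifold 𝓘(ℝ, E) ∞ X]

/-- The coordinate frame at the point with coordinates `y` in the chart around `c`, sending
a coordinate vector to the corresponding tangent vector. -/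
def frame (c : X) (y : E) : E →L[ℝ] T E (pt c y) :=
  (trivializationAt E (TangentSpace 𝓘(ℝ, E)) c).symmL ℝ (pt c y)

/-- The dual coframe, sending a tangent vector to its components in the chart around `c`. -/
def coframe (c : X) (y : E) : T E (pt c y) →L[ℝ] E :=
  (trivializationAt E (TangentSpace 𝓘(ℝ, E)) c).continuousLinearMapAt ℝ (pt c y)

/-- The frame is the derivative of the inverse chart. -/
theorem frame_eq_mfderiv (c : X) {y : E} (hy : y ∈ coordDomain E c) :
    frame c y = mfderiv 𝓘(ℝ, E) 𝓘(ℝ, E) (extChartAt 𝓘(ℝ, E) c).symm y := by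
  have h : pt c y ∈ (chartAt E c).source := by
    have := (extChartAt 𝓘(ℝ, E) c).map_target hy
    rwa [extChartAt_source] at this
  have h2 : extChartAt 𝓘(ℝ, E) c ((extChartAt 𝓘(ℝ, E) c).symm y) = y :=
    (extChartAt 𝓘(ℝ, E) c).right_inv hy
  unfold frame
  rw [TangentBundle.symmL_trivializationAt h]
  simp only [modelWithCornersSelf_coe, Set.range_id, mfderivWithin_univ]
  rw [h2]

/-- The coframe is the derivative of the chart. -/
theorem coframe_eq_mfderiv (c : X) {y : E} (hy : y ∈ coordDomain E c) :
    coframe c y = mfderiv 𝓘(ℝ, E) 𝓘(ℝ, E) (extChartAt 𝓘(ℝ, E) c) (pt c y) := by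
  have h : pt c y ∈ (chartAt E c).source := by
    have := (extChartAt 𝓘(ℝ, E) c).map_target hy
    rwa [extChartAt_source] at this
  exact TangentBundle.continuousLinearMapAt_trivializationAt h

variable (E X) in
/-- The set `ℳ` of smooth Riemannian metrics on `X`. -/
abbrev Metric : Type _ :=
  Bundle.ContMDiffRiemannianMetric 𝓘(ℝ, E) ∞ E (fun x : X => TangentSpace 𝓘(ℝ, E) x)

/-- The coordinate expression `g (∂ᵤ, ∂ᵥ)` of a metric in the chart around `c`. -/
def metricExpr (g : Metric E X) (c : X) (y : E) : Bil E :=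
  (ContinuousLinearMap.precomp ℝ (frame c y)) ∘L (g.inner (pt c y)) ∘L (frame c y)

theorem metricExpr_apply (g : Metric E X) (c : X) (y u v : E) :
    metricExpr g c y u v = g.inner (pt c y) (frame c y u) (frame c y v) := rfl

/-- A family of metrics `(g_t)` on `X` is smooth if `(t, x) ↦ g_t (x)` is smooth. -/
def IsSmoothFamily (g : ℝ → Metric E X) : Prop :=
  ContMDiff (𝓘(ℝ, ℝ).prod 𝓘(ℝ, E)) (𝓘(ℝ, E).prod 𝓘(ℝ, E →L[ℝ] E →L[ℝ] ℝ)) ∞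
    (fun p : ℝ × X => Bundle.TotalSpace.mk' (E →L[ℝ] E →L[ℝ] ℝ)
      (E := fun x : X => T E x →L[ℝ] T E x →L[ℝ] ℝ) p.2 ((g p.1).inner p.2))

/-- The coordinate expression of the variation `ġ_t = (d/dt) g_t` in the chart around `c`. -/
def variationExpr (g : ℝ → Metric E X) (t : ℝ) (c : X) (y : E) : Bil E :=
  deriv (fun s => metricExpr (g s) c y) t

variable (E X) in
/-- A field of endomorphisms of the tangent spaces. -/
abbrev EndField : Type _ := ∀ x : X, T E x →L[ℝ] T E x

/-- Smoothness of a field of endomorphisms, i.e. `K ∈ C^∞ (X, End (T_X))`. -/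
def EndField.IsSmooth (K : EndField E X) : Prop :=
  ContMDiff 𝓘(ℝ, E) (𝓘(ℝ, E).prod 𝓘(ℝ, E →L[ℝ] E)) ∞
    (fun x : X => Bundle.TotalSpace.mk' (E →L[ℝ] E) (E := fun x : X => T E x →L[ℝ] T E x) x (K x))

/-- The coordinate expression of a field of endomorphisms in the chart around `c`. -/
def endExpr (K : EndField E X) (c : X) (y : E) : E →L[ℝ] E :=
  coframe c y ∘L K (pt c y) ∘L frame c y

/-- `K (x)` has `n = dim X` distinct real eigenvalues. -/
def HasDistinctRealEigenvalues (K : EndField E X) (x : X) : Prop :=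
  ∃ μ : Fin (Module.finrank ℝ E) → ℝ, Function.Injective μ ∧
    ∀ i, Module.End.HasEigenvalue (K x).toLinearMap (μ i)

variable (E X) in
/-- A smooth volume form on `X`: a nowhere vanishing smooth differential form of degree
`n = dim X`.  The manifold is oriented by it. -/
structure VolumeForm [FiniteDimensional ℝ E] where
  /-- The alternating form at each point. -/
  form (x : X) : (T E x) [⋀^Fin (Module.finrank ℝ E)]→ₗ[ℝ] ℝ
  ne_zero (x : X) : form x ≠ 0
  smooth (c : X) : ContDiffOn ℝ ∞
    (fun y : E => form (pt c y) (fun i => frame c y (Module.finBasis ℝ E i))) (coordDomain E c)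

variable [FiniteDimensional ℝ E]

/-- The coordinate expression `Ω (∂₁, …, ∂ₙ)` of a volume form in the chart around `c`. -/
def volExpr (Ω : VolumeForm E X) (c : X) (y : E) : ℝ :=
  Ω.form (pt c y) (fun i => frame c y (Module.finBasis ℝ E i))

/-- The space `𝔽^K_g`.  A covariant `2`-tensor field `v` on `X` is given by its coordinate
expressions `v c : E → Bil E`, one for the chart around each `c : X`; it belongs to `𝔽^K_g` if
it is smooth and symmetric, the covariant exterior derivative of `v* = g⁻¹ v` vanishes, i.e.
`(∇_ξ v*) η = (∇_η v*) ξ`, and `∇ᵖ_ξ v*` commutes with `K` and with the curvature of `g`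
for all `p ≥ 0` and `ξ`.  The conditions are tensorial, and they are imposed at every point of
every chart. -/
def MemFK (g : Metric E X) (K : EndField E X) (v : X → E → Bil E) : Prop :=
  ∀ c : X, ContDiffOn ℝ ∞ (v c) (coordDomain E c) ∧ ∀ y ∈ coordDomain E c,
    let γ := metricExpr g c
    let vstar := fun z => raise (γ z) (v c z)
    (∀ ξ η, v c y ξ η = v c y η ξ) ∧
    (∀ ξ η, iterCovDeriv γ vstar 1 y ![ξ] η = iterCovDeriv γ vstar 1 y ![η] ξ) ∧
    (∀ (p : ℕ) (ξ : Fin p → E),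
      Commute (endExpr K c y) (iterCovDeriv γ vstar p y ξ) ∧
      ∀ u w, Commute (curvature γ y u w) (iterCovDeriv γ vstar p y ξ))

/-- The coordinate expressions of the tensor `Ric_g (Ω)`. -/
def bakryEmeryRicciExpr (Ω : VolumeForm E X) (g : Metric E X) (c : X) (y : E) : Bil E :=
  bakryEmeryRicci (metricExpr g c) (volExpr Ω c) y

/-- The set `𝒮^K_Ω` of scattering data with center `K`: the metrics `g` such that
`Ric_g (Ω) ∈ 𝔽^K_g`. -/
def scatteringData (Ω : VolumeForm E X) (K : EndField E X) : Set (Metric E X) :=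
  {g | MemFK g K (bakryEmeryRicciExpr Ω g)}

end Global

end ScatteringData

end

/-! All conditions are imposed chart by chart, and the evolution equations below are ordinary
differential equations at each point of space, so one works over a single chart domain `U`, on the
cylinder `cyl U`. Write W = g⁻¹ġ (`velocity`), f = log(dV_g/Ω), H = g⁻¹Ric_g(Ω) (`berEnd`).

Since ∇ġ is totally symmetric, the connection varies by Γ̇(ξ) = ½∇_ξW (`td_gam`). The Ricci identity
then gives Ṙ(ξ,η) = ½[R(ξ,η),W] = 0 (`td_curv`). So the curvature endomorphisms, the Ricci form and
K are constant in time, and the fields that must commute with everything never move. Distinct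
eigenvalues make the centralizer of K commutative on a dense set; by continuity, smooth fields
commuting with K commute with each other everywhere. Hence ∂_t commutes with ∇_ξ on such fields
(`td_cd`).

Because ḟ = ½ tr W (`td_logVol`) and ∇²W is totally symmetric, H solves Ḣ = ½(ΔW − ∇_{grad f}W) − WH
(`td_berEnd`), a linear equation whose coefficients satisfy all the commutation conditions. For a
fixed A among K and the R(u,w), the commutator C = [A,H] satisfies Ċ = −WC, so g(Cv,w) is constant
in time and vanishes if it does at t = 0. Induction on the order handles covariant derivatives
(`propagate`).

For the Codazzi equation, the defect of H is that of Ric minus df(R(ξ,η)ζ)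
(`berEnd_codazzi_defect`). With A = ∇_ζW, the time derivative of the Ricci part vanishes because A
is symmetric for Ric (`ric_slide`), and that of the last term is half the trace of the skew
endomorphism R(ξ,η)A. The defect is thus constant in time. -/

noncomputable section

namespace ScatteringData

set_option linter.unusedSectionVars false

/-! ### Directional derivatives of smooth fields on open sets. -/

section Calculus

variable {M V V₁ V₂ : Type*} [NormedAddCommGroup M] [NormedSpace ℝ M]
  [NormedAddCommGroup V] [NormedSpace ℝ V] [NormedAddCommGroup V₁] [NormedSpace ℝ V₁]
  [NormedAddCommGroup V₂] [NormedSpace ℝ V₂]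

/-- The derivative of `F` in the constant direction `v`. -/
def pd (v : M) (F : M → V) (p : M) : V := fderiv ℝ F p v

/-- Smoothness on an open set, in the form used throughout. -/
def SmoothOn (O : Set M) (F : M → V) : Prop := IsOpen O ∧ ContDiffOn ℝ ∞ F O

namespace SmoothOn

variable {O : Set M} {F F' : M → V} {p : M}

theorem contDiffAt (h : SmoothOn O F) (hp : p ∈ O) : ContDiffAt ℝ ∞ F p :=
  h.2.contDiffAt (h.1.mem_nhds hp)

theorem of_contDiffAt (hO : IsOpen O) (h : ∀ p ∈ O, ContDiffAt ℝ ∞ F p) : SmoothOn O F :=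
  ⟨hO, fun p hp => (h p hp).contDiffWithinAt⟩

theorem differentiableAt (h : SmoothOn O F) (hp : p ∈ O) : DifferentiableAt ℝ F p :=
  (h.contDiffAt hp).differentiableAt (by simp)

theorem continuousOn (h : SmoothOn O F) : ContinuousOn F O := h.2.continuousOn

theorem congr (h : SmoothOn O F) (h' : EqOn F' F O) : SmoothOn O F' := ⟨h.1, h.2.congr h'⟩

theorem const (hO : IsOpen O) (v : V) : SmoothOn O (fun _ : M => v) := ⟨hO, contDiffOn_const⟩

theorem add (h : SmoothOn O F) (h' : SmoothOn O F') : SmoothOn O (fun q => F q + F' q) :=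
  ⟨h.1, h.2.add h'.2⟩

theorem sub (h : SmoothOn O F) (h' : SmoothOn O F') : SmoothOn O (fun q => F q - F' q) :=
  ⟨h.1, h.2.sub h'.2⟩

theorem smul {f : M → ℝ} (hf : SmoothOn O f) (h : SmoothOn O F) :
    SmoothOn O (fun q => f q • F q) := ⟨h.1, hf.2.smul h.2⟩

theorem const_smul (a : ℝ) (h : SmoothOn O F) : SmoothOn O (fun q => a • F q) :=
  ⟨h.1, h.2.const_smul a⟩

theorem clm (L : V →L[ℝ] V₁) (h : SmoothOn O F) : SmoothOn O (fun q => L (F q)) :=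
  ⟨h.1, L.contDiff.comp_contDiffOn h.2⟩

theorem apply {L : M → V →L[ℝ] V₁} (hL : SmoothOn O L) (h : SmoothOn O F) :
    SmoothOn O (fun q => L q (F q)) := ⟨h.1, hL.2.clm_apply h.2⟩

theorem apply_const {L : M → V →L[ℝ] V₁} (hL : SmoothOn O L) (v : V) :
    SmoothOn O (fun q => L q v) := hL.apply (const hL.1 v)

theorem comp {L : M → V₁ →L[ℝ] V₂} {L' : M → V →L[ℝ] V₁} (hL : SmoothOn O L)
    (hL' : SmoothOn O L') : SmoothOn O (fun q => (L q).comp (L' q)) := ⟨hL.1, hL.2.clm_comp hL'.2⟩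

theorem mul {A B : M → V →L[ℝ] V} (hA : SmoothOn O A) (hB : SmoothOn O B) :
    SmoothOn O (fun q => A q * B q) := hA.comp hB

theorem sum {ι : Type*} {s : Finset ι} {A : ι → M → V} (hO : IsOpen O)
    (h : ∀ i ∈ s, SmoothOn O (A i)) : SmoothOn O (fun q => ∑ i ∈ s, A i q) :=
  ⟨hO, ContDiffOn.sum fun i hi => (h i hi).2⟩

theorem fderiv (h : SmoothOn O F) : SmoothOn O (fun q => _root_.fderiv ℝ F q) :=
  ⟨h.1, h.2.fderiv_of_isOpen h.1 (by simp)⟩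

theorem pd (v : M) (h : SmoothOn O F) : SmoothOn O (pd v F) := h.fderiv.apply_const v

end SmoothOn

variable {O : Set M} {F F' : M → V} {p : M}

theorem pd_congr (hO : IsOpen O) (h : EqOn F F' O) (v : M) (hp : p ∈ O) : pd v F p = pd v F' p := by
  have : F =ᶠ[nhds p] F' := by
    filter_upwards [hO.mem_nhds hp] with q hq using h hq
  rw [pd, pd, this.fderiv_eq]

theorem pd_const (v : M) (c : V) : pd v (fun _ : M => c) p = 0 := by simp [pd]

theorem pd_add (v : M) (h : SmoothOn O F) (h' : SmoothOn O F') (hp : p ∈ O) :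
    pd v (fun q => F q + F' q) p = pd v F p + pd v F' p := by
  simp only [pd]; rw [fderiv_fun_add (h.differentiableAt hp) (h'.differentiableAt hp)]; rfl

theorem pd_sub (v : M) (h : SmoothOn O F) (h' : SmoothOn O F') (hp : p ∈ O) :
    pd v (fun q => F q - F' q) p = pd v F p - pd v F' p := by
  simp only [pd]; rw [fderiv_fun_sub (h.differentiableAt hp) (h'.differentiableAt hp)]; rfl

theorem pd_const_smul (v : M) (a : ℝ) (h : SmoothOn O F) (hp : p ∈ O) :
    pd v (fun q => a • F q) p = a • pd v F p := by
  simp only [pd]; rw [fderiv_fun_const_smul (h.differentiableAt hp)]; rfl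

theorem pd_smul (v : M) {f : M → ℝ} (hf : SmoothOn O f) (h : SmoothOn O F) (hp : p ∈ O) :
    pd v (fun q => f q • F q) p = pd v f p • F p + f p • pd v F p := by
  simp only [pd]; rw [fderiv_fun_smul (hf.differentiableAt hp) (h.differentiableAt hp)]
  simp [add_comm]

theorem pd_sum (v : M) {ι : Type*} {s : Finset ι} {A : ι → M → V}
    (h : ∀ i ∈ s, SmoothOn O (A i)) (hp : p ∈ O) :
    pd v (fun q => ∑ i ∈ s, A i q) p = ∑ i ∈ s, pd v (A i) p := by
  simp only [pd]; rw [fderiv_fun_sum fun i hi => (h i hi).differentiableAt hp]; simp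

theorem pd_clm (v : M) (L : V →L[ℝ] V₁) (h : SmoothOn O F) (hp : p ∈ O) :
    pd v (fun q => L (F q)) p = L (pd v F p) := by
  simp only [pd]
  have := (L.hasFDerivAt.comp p (h.differentiableAt hp).hasFDerivAt).fderiv
  rw [Function.comp_def] at this
  rw [this]; rfl

theorem pd_apply (v : M) {L : M → V →L[ℝ] V₁} (hL : SmoothOn O L) (h : SmoothOn O F) (hp : p ∈ O) :
    pd v (fun q => L q (F q)) p = pd v L p (F p) + L p (pd v F p) := by
  simp only [pd]; rw [fderiv_clm_apply (hL.differentiableAt hp) (h.differentiableAt hp)]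
  simp [add_comm]

theorem pd_apply_const (v : M) {L : M → V →L[ℝ] V₁} (hL : SmoothOn O L) (w : V) (hp : p ∈ O) :
    pd v (fun q => L q w) p = pd v L p w := by
  rw [pd_apply v hL (.const hL.1 w) hp, pd_const]; simp

theorem pd_comp (v : M) {L : M → V₁ →L[ℝ] V₂} {L' : M → V →L[ℝ] V₁} (hL : SmoothOn O L)
    (hL' : SmoothOn O L') (hp : p ∈ O) :
    pd v (fun q => (L q).comp (L' q)) p = (pd v L p).comp (L' p) + (L p).comp (pd v L' p) := by
  simp only [pd]; rw [fderiv_clm_comp (hL.differentiableAt hp) (hL'.differentiableAt hp)]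
  simp [add_comm]

theorem pd_mul (v : M) {A B : M → V →L[ℝ] V} (hA : SmoothOn O A) (hB : SmoothOn O B) (hp : p ∈ O) :
    pd v (fun q => A q * B q) p = pd v A p * B p + A p * pd v B p := pd_comp v hA hB hp

theorem pd_comm (v w : M) (h : SmoothOn O F) (hp : p ∈ O) :
    pd v (pd w F) p = pd w (pd v F) p := by
  have h1 : ∀ a b : M, pd a (pd b F) p = fderiv ℝ (fderiv ℝ F) p a b := fun a b =>
    pd_apply_const a h.fderiv b hp
  rw [h1, h1]
  exact (h.contDiffAt hp).isSymmSndFDerivAt (by simpa using ENat.LEInfty.out) v w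

theorem pd_vec_add (v w : M) : pd (v + w) F p = pd v F p + pd w F p := by simp [pd]

theorem pd_vec_smul (a : ℝ) (v : M) : pd (a • v) F p = a • pd v F p := by simp [pd]

/-- Leibniz rule for `A (F, F')`, where `A` is a field of bilinear forms. -/
theorem pd_apply₂ (v : M) {A : M → V →L[ℝ] V₁ →L[ℝ] V₂} {B : M → V₁}
    (hA : SmoothOn O A) (h : SmoothOn O F) (hB : SmoothOn O B) (hp : p ∈ O) :
    pd v (fun q => A q (F q) (B q)) p =
      pd v A p (F p) (B p) + A p (pd v F p) (B p) + A p (F p) (pd v B p) := by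
  rw [pd_apply v (hA.apply h) hB hp, pd_apply v hA h hp]; rfl

end Calculus

/-! ### Jacobi's formula for the derivative of a determinant. -/

section Det

variable {n : Type*} [Fintype n] [DecidableEq n]

theorem contDiff_det : ContDiff ℝ ∞ (fun A : n → n → ℝ => Matrix.det (Matrix.of A)) := by
  simp only [Matrix.det_apply, Matrix.of_apply]
  fun_prop

theorem fderiv_det_one (N : n → n → ℝ) :
    fderiv ℝ (fun A : n → n → ℝ => Matrix.det (Matrix.of A)) (Matrix.of.symm 1) N =
      Matrix.trace (Matrix.of N) := by
  have h1 := (contDiff_det.differentiable (by simp)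
    (Matrix.of.symm (1 : Matrix n n ℝ))).hasFDerivAt
  have h2 : HasDerivAt (fun s : ℝ => Matrix.of.symm (1 : Matrix n n ℝ) + s • N) N 0 := by
    simpa using ((hasDerivAt_id (0 : ℝ)).smul_const N).const_add (Matrix.of.symm (1 : Matrix n n ℝ))
  have h3 := HasFDerivAt.comp_hasDerivAt_of_eq (0 : ℝ) h1 h2 (by simp)
  have h4 : HasDerivAt (fun s : ℝ => Matrix.det (1 + s • Matrix.of N))
      (Matrix.trace (Matrix.of N)) 0 := by
    have := (Matrix.derivative_det_one_add_X_smul (Matrix.of N))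
    rw [← this]
    have h5 := Polynomial.hasDerivAt
      (Matrix.det (1 + (Polynomial.X : Polynomial ℝ) • (Matrix.of N).map Polynomial.C)) (0 : ℝ)
    refine h5.congr_of_eventuallyEq (Filter.Eventually.of_forall fun s => ?_)
    change _ = Polynomial.eval s _
    rw [← Polynomial.coe_evalRingHom, RingHom.map_det]
    refine congrArg Matrix.det ?_
    ext i j
    by_cases hij : i = j <;> simp [hij] <;> ring
  exact h3.unique h4

/-- Jacobi's formula: if `A' = N A` at `t`, then `(det A)' = Tr N * det A` at `t`. -/
theorem hasDerivAt_det {A : ℝ → Matrix n n ℝ} {N : Matrix n n ℝ} {t : ℝ} (hdet : IsUnit (A t).det)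
    (hA : ∀ i j, HasDerivAt (fun s => A s i j) ((N * A t) i j) t) :
    HasDerivAt (fun s => (A s).det) (N.trace * (A t).det) t := by
  have h1 := (contDiff_det.differentiable (by simp)
    (Matrix.of.symm (1 : Matrix n n ℝ))).hasFDerivAt
  -- Right multiplication by the fixed inverse of A(t) moves the base point to the identity, where
  -- the velocity is N.
  have h2 : HasDerivAt (fun s => Matrix.of.symm (A s * (A t)⁻¹)) (Matrix.of.symm N) t := by
    rw [hasDerivAt_pi]; intro i
    rw [hasDerivAt_pi]; intro j
    have h3 : N = N * A t * (A t)⁻¹ := by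
      rw [Matrix.mul_assoc, Matrix.mul_nonsing_inv _ hdet, Matrix.mul_one]
    have h4 : N i j = ∑ k, (N * A t) i k * (A t)⁻¹ k j := by
      conv_lhs => rw [h3]
      rfl
    simp only [Matrix.of_symm_apply]
    rw [h4]
    simp only [Matrix.mul_apply (M := A _)]
    exact HasDerivAt.fun_sum fun k _ => (hA i k).mul_const _
  have h5 := HasFDerivAt.comp_hasDerivAt_of_eq t h1 h2
    (by rw [Matrix.mul_nonsing_inv _ hdet])
  rw [fderiv_det_one] at h5
  have h6 := h5.mul_const (A t).det
  refine h6.congr_of_eventuallyEq (Filter.Eventually.of_forall fun s => ?_)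
  change _ = (A s * (A t)⁻¹).det * (A t).det
  rw [← Matrix.det_mul, Matrix.mul_assoc, Matrix.nonsing_inv_mul _ hdet, Matrix.mul_one]

end Det

/-! ### Space and time derivatives on a cylinder. -/

section SpaceTime

variable {E V : Type*} [NormedAddCommGroup E] [NormedSpace ℝ E]
  [NormedAddCommGroup V] [NormedSpace ℝ V]

/-- The space-time cylinder over `U`. -/
abbrev cyl (U : Set E) : Set (ℝ × E) := (univ : Set ℝ) ×ˢ U

/-- The derivative in a spatial direction. -/
abbrev sd (ξ : E) (F : ℝ × E → V) : ℝ × E → V := pd ((0, ξ) : ℝ × E) F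

/-- The derivative in time. -/
abbrev td (F : ℝ × E → V) : ℝ × E → V := pd ((1, 0) : ℝ × E) F

theorem hasFDerivAt_slice {F : ℝ × E → V} {t : ℝ} {y : E} (h : DifferentiableAt ℝ F (t, y)) :
    HasFDerivAt (fun z => F (t, z)) ((fderiv ℝ F (t, y)).comp (ContinuousLinearMap.inr ℝ ℝ E)) y :=
  h.hasFDerivAt.comp y (hasFDerivAt_prodMk_right t y)

theorem fderiv_slice {F : ℝ × E → V} {t : ℝ} {y : E} (h : DifferentiableAt ℝ F (t, y)) (ξ : E) :
    fderiv ℝ (fun z => F (t, z)) y ξ = sd ξ F (t, y) := by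
  rw [(hasFDerivAt_slice h).fderiv]; simp [pd]

theorem hasDerivAt_time {F : ℝ × E → V} {t : ℝ} {y : E} (h : DifferentiableAt ℝ F (t, y)) :
    HasDerivAt (fun s => F (s, y)) (td F (t, y)) t := by
  have := (h.hasFDerivAt.comp t (hasFDerivAt_prodMk_left t y)).hasDerivAt
  simpa [pd, Function.comp_def] using this

theorem SmoothOn.slice {U : Set E} {F : ℝ × E → V} (h : SmoothOn (cyl U) F) (t : ℝ) :
    ContDiffOn ℝ ∞ (fun z => F (t, z)) U :=
  h.2.comp (contDiff_prodMk_right t).contDiffOn fun _ hz => ⟨mem_univ _, hz⟩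

theorem SmoothOn.of_slice {U : Set E} (hU : IsOpen U) {F : E → V} (h : ContDiffOn ℝ ∞ F U) :
    SmoothOn (cyl U) (fun p : ℝ × E => F p.2) :=
  ⟨isOpen_univ.prod hU, h.comp contDiff_snd.contDiffOn fun _ hp => hp.2⟩

/-- A field whose time derivative vanishes is constant in time. -/
theorem eq_of_td_eq_zero {U : Set E} {F : ℝ × E → V} (h : SmoothOn (cyl U) F)
    (h0 : ∀ p ∈ cyl U, td F p = 0) {p : ℝ × E} (hp : p ∈ cyl U) : F p = F (0, p.2) := by
  have hd : ∀ s, HasDerivAt (fun s => F (s, p.2)) 0 s := fun s => by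
    have hs : (s, p.2) ∈ cyl U := ⟨mem_univ _, hp.2⟩
    simpa [h0 _ hs] using hasDerivAt_time (h.differentiableAt hs)
  exact is_const_of_deriv_eq_zero (fun s => (hd s).differentiableAt) (fun s => (hd s).deriv) p.1 0

theorem sd_add (ξ η : E) (F : ℝ × E → V) (p : ℝ × E) : sd (ξ + η) F p = sd ξ F p + sd η F p := by
  have : ((0, ξ + η) : ℝ × E) = (0, ξ) + (0, η) := by simp
  rw [sd, this, pd_vec_add]

theorem sd_smul (a : ℝ) (ξ : E) (F : ℝ × E → V) (p : ℝ × E) : sd (a • ξ) F p = a • sd ξ F p := by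
  have : ((0, a • ξ) : ℝ × E) = a • (0, ξ) := by simp
  rw [sd, this, pd_vec_smul]

end SpaceTime

/-! ### Levi-Civita connection and curvature of a time-dependent metric. -/

section Connection

variable {E : Type*} [NormedAddCommGroup E] [NormedSpace ℝ E]

/-- The Christoffel symbols of a family of metrics. -/
def gam (G : ℝ × E → Bil E) (u : E) (p : ℝ × E) : E →L[ℝ] E :=
  christoffel (fun z => G (p.1, z)) p.2 u

/-- The covariant derivative of a field of endomorphisms in a constant direction. -/
def cd (G : ℝ × E → Bil E) (ξ : E) (F : ℝ × E → E →L[ℝ] E) (p : ℝ × E) : E →L[ℝ] E :=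
  sd ξ F p + (gam G ξ p * F p - F p * gam G ξ p)

/-- The curvature of a family of metrics. -/
def curv (G : ℝ × E → Bil E) (u v : E) (p : ℝ × E) : E →L[ℝ] E :=
  sd u (gam G v) p - sd v (gam G u) p + (gam G u p * gam G v p - gam G v p * gam G u p)

theorem cd_add_dir (G : ℝ × E → Bil E) (ξ η : E) (F : ℝ × E → E →L[ℝ] E) (p : ℝ × E) :
    cd G (ξ + η) F p = cd G ξ F p + cd G η F p := by
  simp only [cd, sd_add, gam, christoffel_add]; noncomm_ring

theorem cd_smul_dir (G : ℝ × E → Bil E) (a : ℝ) (ξ : E) (F : ℝ × E → E →L[ℝ] E) (p : ℝ × E) :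
    cd G (a • ξ) F p = a • cd G ξ F p := by
  simp only [cd, sd_smul, gam, christoffel_smul, smul_mul_assoc, mul_smul_comm, smul_add, smul_sub]

/-- The covariant derivative at a point, as a linear map of the direction. -/
def cdLin (G : ℝ × E → Bil E) (F : ℝ × E → E →L[ℝ] E) (p : ℝ × E) : E →ₗ[ℝ] (E →L[ℝ] E) where
  toFun ξ := cd G ξ F p
  map_add' ξ η := cd_add_dir G ξ η F p
  map_smul' a ξ := cd_smul_dir G a ξ F p

section

variable {U : Set E} {G : ℝ × E → Bil E} {p : ℝ × E}

theorem cd_add {F F' : ℝ × E → E →L[ℝ] E} (hF : SmoothOn (cyl U) F)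
    (hF' : SmoothOn (cyl U) F') (ξ : E) (hp : p ∈ cyl U) :
    cd G ξ (fun q => F q + F' q) p = cd G ξ F p + cd G ξ F' p := by
  simp only [cd, sd, pd_add _ hF hF' hp]; noncomm_ring

theorem cd_sub {F F' : ℝ × E → E →L[ℝ] E} (hF : SmoothOn (cyl U) F)
    (hF' : SmoothOn (cyl U) F') (ξ : E) (hp : p ∈ cyl U) :
    cd G ξ (fun q => F q - F' q) p = cd G ξ F p - cd G ξ F' p := by
  simp only [cd, sd, pd_sub _ hF hF' hp]; noncomm_ring

theorem cd_smul {f : ℝ × E → ℝ} {F : ℝ × E → E →L[ℝ] E}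
    (hf : SmoothOn (cyl U) f) (hF : SmoothOn (cyl U) F) (ξ : E) (hp : p ∈ cyl U) :
    cd G ξ (fun q => f q • F q) p = sd ξ f p • F p + f p • cd G ξ F p := by
  simp only [cd, sd, pd_smul _ hf hF hp, smul_mul_assoc, mul_smul_comm, smul_add, smul_sub]
  abel

theorem cd_mul {F F' : ℝ × E → E →L[ℝ] E} (hF : SmoothOn (cyl U) F)
    (hF' : SmoothOn (cyl U) F') (ξ : E) (hp : p ∈ cyl U) :
    cd G ξ (fun q => F q * F' q) p = cd G ξ F p * F' p + F p * cd G ξ F' p := by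
  simp only [cd, sd, pd_mul _ hF hF' hp]; noncomm_ring

end

/-- A smooth family of Riemannian metrics on an open subset of the coordinate space. -/
structure IsMetricFamily (U : Set E) (G : ℝ × E → Bil E) : Prop where
  smooth : SmoothOn (cyl U) G
  symm : ∀ p ∈ cyl U, ∀ ξ η, G p ξ η = G p η ξ
  pos : ∀ p ∈ cyl U, ∀ ξ, ξ ≠ 0 → 0 < G p ξ ξ

end Connection

namespace IsMetricFamily

variable {E : Type*} [NormedAddCommGroup E] [NormedSpace ℝ E] [FiniteDimensional ℝ E]
  {U : Set E} {G : ℝ × E → Bil E} {p : ℝ × E}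

theorem isOpen (hG : IsMetricFamily U G) : IsOpen (cyl U) := hG.smooth.1

theorem ext_of (hG : IsMetricFamily U G) (hp : p ∈ cyl U) {v w : E}
    (h : ∀ z, G p v z = G p w z) : v = w := by
  by_contra hne
  have := hG.pos p hp (v - w) (sub_ne_zero.2 hne)
  simp only [map_sub, sub_apply, h, sub_self] at this
  exact lt_irrefl _ this

theorem end_ext (hG : IsMetricFamily U G) (hp : p ∈ cyl U) {A B : E →L[ℝ] E}
    (h : ∀ v z, G p (A v) z = G p (B v) z) : A = B :=
  ContinuousLinearMap.ext fun v => hG.ext_of hp (h v)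

/-- Positivity gives injectivity, and E and its dual have equal dimension. As
`ContinuousLinearMap.inverse` is zero on non-invertible maps, this is what gives `raise` its
meaning. -/
theorem invertible (hG : IsMetricFamily U G) (hp : p ∈ cyl U) : (G p).IsInvertible := by
  have hinj : Function.Injective (G p).toLinearMap := fun v w h =>
    hG.ext_of hp fun z => by
      have : G p v = G p w := h
      rw [this]
  have hfr : Module.finrank ℝ E = Module.finrank ℝ (E →L[ℝ] ℝ) := by
    rw [← (LinearMap.toContinuousLinearMap (𝕜 := ℝ) (E := E) (F' := ℝ)).finrank_eq,
      Subspace.dual_finrank_eq]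
  refine ⟨(LinearEquiv.ofInjectiveOfFinrankEq (G p).toLinearMap hinj
    hfr).toContinuousLinearEquiv, ?_⟩
  ext v w
  rfl

theorem raise_spec (hG : IsMetricFamily U G) (hp : p ∈ cyl U) (b : Bil E) (v w : E) :
    G p (raise (G p) b v) w = b v w := by
  rw [raise, ContinuousLinearMap.comp_apply, (hG.invertible hp).self_apply_inverse]

theorem smooth_inverse (hG : IsMetricFamily U G) :
    SmoothOn (cyl U) (fun p => ContinuousLinearMap.inverse (G p)) := by
  have := FiniteDimensional.complete ℝ E
  exact .of_contDiffAt hG.isOpen fun p hp =>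
    ((hG.invertible hp).contDiffAt_map_inverse).comp p (hG.smooth.contDiffAt hp)

theorem smooth_raise (hG : IsMetricFamily U G) {B : ℝ × E → Bil E} (hB : SmoothOn (cyl U) B) :
    SmoothOn (cyl U) (fun p => raise (G p) (B p)) := hG.smooth_inverse.comp hB

-- The spatial derivative of a slice is the space-time derivative composed with the inclusion of E,
-- which is smooth jointly in time and space; flips are continuous linear.
set_option maxSynthPendingDepth 5 in
theorem smooth_christoffelLower (hG : IsMetricFamily U G) (u : E) :
    SmoothOn (cyl U) (fun p => christoffelLower (fun z => G (p.1, z)) p.2 u) := by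
  set dG : ℝ × E → E →L[ℝ] Bil E := fun p =>
    (fderiv ℝ G p).comp (ContinuousLinearMap.inr ℝ ℝ E)
  have hd : SmoothOn (cyl U) dG := hG.smooth.fderiv.comp (.const hG.isOpen _)
  have hf : SmoothOn (cyl U) (fun p => (dG p).flip u) :=
    SmoothOn.apply_const (hd.clm (ContinuousLinearMap.flipₗᵢ ℝ E E
      (E →L[ℝ] ℝ)).toContinuousLinearEquiv.toContinuousLinearMap) u
  have hff : SmoothOn (cyl U) (fun p => ((dG p).flip u).flip) :=
    hf.clm (V₁ := Bil E)
      (ContinuousLinearMap.flipₗᵢ ℝ E E ℝ).toContinuousLinearEquiv.toContinuousLinearMap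
  refine ((((hd.apply_const u).add hf).sub hff).const_smul (1 / 2)).congr fun p hp => ?_
  have : fderiv ℝ (fun z => G (p.1, z)) p.2 = dG p :=
    (hasFDerivAt_slice (hG.smooth.differentiableAt (p := (p.1, p.2)) hp)).fderiv
  simp only [christoffelLower, this]

theorem smooth_gam (hG : IsMetricFamily U G) (u : E) : SmoothOn (cyl U) (gam G u) :=
  hG.smooth_raise (hG.smooth_christoffelLower u)

/-- The Koszul formula on constant vector fields, whose brackets vanish. -/
theorem gam_spec (hG : IsMetricFamily U G) (hp : p ∈ cyl U) (u v w : E) :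
    G p (gam G u p v) w = (1 / 2) * (sd u G p v w + sd v G p u w - sd w G p u v) := by
  have h := hG.raise_spec hp (christoffelLower (fun z => G (p.1, z)) p.2 u) v w
  have hs := fun ξ => fderiv_slice (hG.smooth.differentiableAt (p := (p.1, p.2)) hp) ξ
  rw [christoffelLower_apply, hs, hs, hs] at h
  exact h

theorem smooth_cd (hG : IsMetricFamily U G) {F : ℝ × E → E →L[ℝ] E} (hF : SmoothOn (cyl U) F)
    (ξ : E) : SmoothOn (cyl U) (cd G ξ F) :=
  (hF.pd _).add (((hG.smooth_gam ξ).mul hF).sub (hF.mul (hG.smooth_gam ξ)))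

theorem smooth_curv (hG : IsMetricFamily U G) (u v : E) : SmoothOn (cyl U) (curv G u v) :=
  (((hG.smooth_gam v).pd _).sub ((hG.smooth_gam u).pd _)).add
    (((hG.smooth_gam u).mul (hG.smooth_gam v)).sub ((hG.smooth_gam v).mul (hG.smooth_gam u)))

theorem sd_symm (hG : IsMetricFamily U G) (hp : p ∈ cyl U) (v : ℝ × E) (ξ η : E) :
    pd v G p ξ η = pd v G p η ξ := by
  have h := pd_congr hG.isOpen (F := fun q => G q ξ η) (F' := fun q => G q η ξ)
    (fun q hq => hG.symm q hq ξ η) v hp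
  rwa [pd_apply_const v (hG.smooth.apply_const ξ) η hp, pd_apply_const v hG.smooth ξ hp,
    pd_apply_const v (hG.smooth.apply_const η) ξ hp, pd_apply_const v hG.smooth η hp] at h

/-- The Levi-Civita connection is torsion-free. -/
theorem gam_symm (hG : IsMetricFamily U G) (hp : p ∈ cyl U) (u v : E) :
    gam G u p v = gam G v p u := by
  refine hG.ext_of hp fun w => ?_
  rw [hG.gam_spec hp, hG.gam_spec hp, hG.sd_symm hp _ u v]
  ring

/-- The Levi-Civita connection is metric. -/
theorem sd_metric (hG : IsMetricFamily U G) (hp : p ∈ cyl U) (ξ v w : E) :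
    sd ξ G p v w = G p (gam G ξ p v) w + G p v (gam G ξ p w) := by
  rw [hG.symm p hp v, hG.gam_spec hp, hG.gam_spec hp, hG.sd_symm hp _ w v,
    hG.sd_symm hp _ ξ v, hG.sd_symm hp _ ξ w]
  ring

/-- Leibniz rule for the metric pairing of two vector fields. -/
theorem sd_pairing (hG : IsMetricFamily U G) (hp : p ∈ cyl U) (ξ : E) {A B : ℝ × E → E}
    (hA : SmoothOn (cyl U) A) (hB : SmoothOn (cyl U) B) :
    sd ξ (fun q => G q (A q) (B q)) p =
      G p (sd ξ A p + gam G ξ p (A p)) (B p) + G p (A p) (sd ξ B p + gam G ξ p (B p)) := by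
  rw [sd, pd_apply₂ _ hG.smooth hA hB hp, ← sd, hG.sd_metric hp]
  simp only [map_add, add_apply]
  ring

/-- Differentiate the self-adjointness relation on constant vectors, using that the connection is
metric. -/
theorem cd_selfAdjoint (hG : IsMetricFamily U G) {F : ℝ × E → E →L[ℝ] E}
    (hF : SmoothOn (cyl U) F) (h : ∀ p ∈ cyl U, ∀ v w, G p (F p v) w = G p v (F p w)) (ξ : E)
    (hp : p ∈ cyl U) (v w : E) : G p (cd G ξ F p v) w = G p v (cd G ξ F p w) := by
  have hc := fun v : E => SmoothOn.const hG.isOpen v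
  have h1 := pd_congr hG.isOpen (F := fun q => G q (F q v) w) (F' := fun q => G q v (F q w))
    (fun q hq => h q hq v w) (0, ξ) hp
  rw [← sd, ← sd, hG.sd_pairing hp ξ (hF.apply_const v) (hc w),
    hG.sd_pairing hp ξ (hc v) (hF.apply_const w)]
    at h1
  simp only [sd, pd_const, pd_apply_const _ hF _ hp, zero_add] at h1
  simp only [cd, add_apply, sub_apply, mul_apply_eq_comp, map_add, map_sub] at h1 ⊢
  have h2 := h p hp (gam G ξ p v) w
  have h3 := h p hp v (gam G ξ p w)
  linarith

theorem cd_eqOn (hG : IsMetricFamily U G) {F F' : ℝ × E → E →L[ℝ] E} (h : EqOn F F' (cyl U))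
    (ξ : E) : EqOn (cd G ξ F) (cd G ξ F') (cyl U) := fun p hp => by
  rw [cd, cd, sd, pd_congr hG.isOpen h _ hp, h hp]

/-- The Ricci identity for fields of endomorphisms. -/
theorem ricci_identity (hG : IsMetricFamily U G) {F : ℝ × E → E →L[ℝ] E}
    (hF : SmoothOn (cyl U) F) (ξ η : E) (hp : p ∈ cyl U) :
    cd G ξ (cd G η F) p - cd G η (cd G ξ F) p = curv G ξ η p * F p - F p * curv G ξ η p := by
  have h : ∀ ξ η, sd ξ (cd G η F) p = sd ξ (sd η F) p + (sd ξ (gam G η) p * F p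
      + gam G η p * sd ξ F p - (sd ξ F p * gam G η p + F p * sd ξ (gam G η) p)) := fun ξ η => by
    have hg := hG.smooth_gam η
    simp only [sd]
    rw [← pd_mul _ hF hg hp, ← pd_mul _ hg hF hp, ← pd_sub _ (hg.mul hF) (hF.mul hg) hp,
      ← pd_add _ (hF.pd _) ((hg.mul hF).sub (hF.mul hg)) hp]
    rfl
  rw [cd, cd.eq_def G η (cd G ξ F), h, h, cd, cd, curv, sd, pd_comm _ _ hF hp]
  noncomm_ring

/-- The curvature is skew-adjoint. -/
theorem curv_skew (hG : IsMetricFamily U G) (hp : p ∈ cyl U) (ξ η v w : E) :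
    G p (curv G ξ η p v) w = - G p v (curv G ξ η p w) := by
  have hc := fun v : E => SmoothOn.const hG.isOpen v
  -- The mixed terms g(Γ_η v, Γ_ξ w) + g(Γ_ξ v, Γ_η w) are symmetric in ξ and η, so exchanging the
  -- two derivatives of g(v,w) leaves only curvature terms.
  have h : ∀ ξ η, sd ξ (sd η (fun q => G q v w)) p =
      G p (sd ξ (gam G η) p v + gam G ξ p (gam G η p v)) w + G p (gam G η p v) (gam G ξ p w)
      + (G p (gam G ξ p v) (gam G η p w)
        + G p v (sd ξ (gam G η) p w + gam G ξ p (gam G η p w))) := by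
    intro ξ η
    have hv := (hG.smooth_gam η).apply_const v
    have hw := (hG.smooth_gam η).apply_const w
    have h1 : EqOn (sd η (fun q => G q v w))
        (fun q => G q (gam G η q v) w + G q v (gam G η q w)) (cyl U) := fun q hq => by
      rw [hG.sd_pairing hq η (hc v) (hc w)]
      simp only [sd, pd_const, zero_add]
    rw [sd, pd_congr hG.isOpen h1 _ hp,
      pd_add _ ((hG.smooth.apply hv).apply (hc w)) ((hG.smooth.apply (hc v)).apply hw) hp,
      ← sd, ← sd, hG.sd_pairing hp ξ hv (hc w), hG.sd_pairing hp ξ (hc v) hw]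
    simp only [sd, pd_const, zero_add, pd_apply_const _ (hG.smooth_gam η) _ hp]
  have h1 := h ξ η
  rw [sd, sd, pd_comm _ _ ((hG.smooth.apply_const v).apply_const w) hp, ← sd, ← sd, h η ξ] at h1
  simp only [curv, add_apply, sub_apply, mul_apply_eq_comp, map_add, map_sub] at h1 ⊢
  linarith

theorem curv_antisymm (ξ η : E) : curv G ξ η p = - curv G η ξ p := by
  simp only [curv]; noncomm_ring

/-- The first Bianchi identity. -/
theorem bianchi (hG : IsMetricFamily U G) (hp : p ∈ cyl U) (u v w : E) :
    curv G u v p w + curv G v w p u + curv G w u p v = 0 := by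
  -- Differentiated torsion-freeness: the derivatives of Γ cancel in pairs in the cyclic sum.
  have h : ∀ a b c, sd a (gam G b) p c = sd a (gam G c) p b := fun a b c => by
    rw [← pd_apply_const _ (hG.smooth_gam b) c hp, ← pd_apply_const _ (hG.smooth_gam c) b hp]
    exact pd_congr hG.isOpen (fun q hq => hG.gam_symm hq b c) _ hp
  simp only [curv, add_apply, sub_apply, mul_apply_eq_comp]
  rw [h u v w, h v w u, h w u v, hG.gam_symm hp v w, hG.gam_symm hp u w, hG.gam_symm hp u v]
  abel

/-- The pair symmetry of the curvature. -/
theorem curv_pair_symm (hG : IsMetricFamily U G) (hp : p ∈ cyl U) (u v w z : E) :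
    G p (curv G u v p w) z = G p (curv G w z p u) v := by
  have hb : ∀ a b c d,
      G p (curv G a b p c) d + G p (curv G b c p a) d + G p (curv G c a p b) d = 0 :=
    fun a b c d => by
      have := congrArg (fun x => G p x d) (hG.bianchi hp a b c)
      simpa using this
  have hs : ∀ a b c d, G p (curv G a b p c) d = - G p (curv G a b p d) c := fun a b c d => by
    rw [hG.curv_skew hp, hG.symm p hp]
  have ha : ∀ a b c d, G p (curv G a b p c) d = - G p (curv G b a p c) d := fun a b c d => by
    rw [curv_antisymm]; simp
  -- The octahedron argument: the Bianchi identities for the four cyclic rotations of (u, v, w, z),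
  -- combined through antisymmetry in the first and in the last pair.
  linarith [hb u v w z, hb v w z u, hb w z u v, hb z u v w, hs u v w z, hs v w z u, hs w z u v,
    hs z u v w, hs u w v z, hs v z w u, ha u v w z, ha v w z u, ha w z u v, ha z u v w,
    ha u w v z, ha v z w u, hs u v z w, hs v w u z, hs w u v z, hs w u z v, hs z v w u, hs u z v w,
    hs v z u w, ha w u v z, ha v z u w, ha z v u w, ha u z v w, ha u w z v, hs u w z v, ha z v w u,
    ha w u z v]

end IsMetricFamily

/-! ### Traces, the Ricci tensor, and first variations of connection and curvature. -/

section RicciTensor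

section Trace

variable {E : Type*} [NormedAddCommGroup E] [NormedSpace ℝ E] [FiniteDimensional ℝ E]

/-- The trace, as a continuous linear form on endomorphisms. -/
def trL (E : Type*) [NormedAddCommGroup E] [NormedSpace ℝ E] [FiniteDimensional ℝ E] :
    (E →L[ℝ] E) →L[ℝ] ℝ :=
  LinearMap.toContinuousLinearMap ((LinearMap.trace ℝ E).comp (ContinuousLinearMap.coeLM ℝ))

theorem trL_apply (A : E →L[ℝ] E) : trL E A = LinearMap.trace ℝ E A.toLinearMap := rfl

theorem trL_mul_comm (A B : E →L[ℝ] E) : trL E (A * B) = trL E (B * A) :=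
  LinearMap.trace_mul_comm ℝ A.toLinearMap B.toLinearMap

/-- The coordinate functionals of the fixed basis. -/
abbrev coordL (i : Fin (Module.finrank ℝ E)) : E →L[ℝ] ℝ :=
  LinearMap.toContinuousLinearMap ((Module.finBasis ℝ E).coord i)

theorem trL_eq_sum (A : E →L[ℝ] E) :
    trL E A = ∑ i, coordL i (A (Module.finBasis ℝ E i)) := by
  rw [trL_apply, LinearMap.trace_eq_matrix_trace ℝ (Module.finBasis ℝ E), Matrix.trace]
  simp [LinearMap.toMatrix_apply]

theorem sum_coordL (v : E) : ∑ i, coordL i v • Module.finBasis ℝ E i = v :=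
  (Module.finBasis ℝ E).sum_repr v

theorem smooth_bilOf {M : Type*} [NormedAddCommGroup M] [NormedSpace ℝ M] {O : Set M}
    (hO : IsOpen O) {B : M → E → (E →L[ℝ] ℝ)}
    (hB : ∀ v, SmoothOn O (fun q => B q v)) : SmoothOn O (fun q => bilOf (B q)) :=
  .sum hO fun j _ => ((hB (Module.finBasis ℝ E j)).clm (V₁ := Bil E)
    (ContinuousLinearMap.smulRightL ℝ E (E →L[ℝ] ℝ) (coordL j)))

end Trace

variable {E : Type*} [NormedAddCommGroup E] [NormedSpace ℝ E] [FiniteDimensional ℝ E]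

/-- The components of the inverse metric. -/
def invMetric (G : ℝ × E → Bil E) (i j : Fin (Module.finrank ℝ E)) (p : ℝ × E) : ℝ :=
  coordL i (ContinuousLinearMap.inverse (G p) (coordL j))

/-- The Ricci tensor of a family of metrics. -/
def ric (G : ℝ × E → Bil E) (p : ℝ × E) : Bil E := ricci (fun z => G (p.1, z)) p.2

/-- The logarithmic time derivative `g⁻¹ (d/dt) g` of a family of metrics. -/
def velocity (G : ℝ × E → Bil E) (p : ℝ × E) : E →L[ℝ] E := raise (G p) (td G p)

namespace IsMetricFamily

variable {U : Set E} {G : ℝ × E → Bil E} {p : ℝ × E}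

theorem smooth_invMetric (hG : IsMetricFamily U G) (i j : Fin (Module.finrank ℝ E)) :
    SmoothOn (cyl U) (invMetric G i j) :=
  (hG.smooth_inverse.apply_const (coordL j)).clm (coordL i)

theorem invMetric_symm (hG : IsMetricFamily U G) (hp : p ∈ cyl U)
    (i j : Fin (Module.finrank ℝ E)) : invMetric G i j p = invMetric G j i p := by
  have h : ∀ i j, invMetric G i j p = G p (ContinuousLinearMap.inverse (G p) (coordL i))
      (ContinuousLinearMap.inverse (G p) (coordL j)) := fun i j => by
    rw [(hG.invertible hp).self_apply_inverse]; rfl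
  rw [h, h, hG.symm p hp]

theorem coordL_eq_sum (hG : IsMetricFamily U G) (hp : p ∈ cyl U) (i : Fin (Module.finrank ℝ E))
    (v : E) : coordL i v = ∑ j, invMetric G i j p * G p v (Module.finBasis ℝ E j) := by
  have h : G p v = ∑ j, G p v (Module.finBasis ℝ E j) • coordL j := by
    ext w
    conv_lhs => rw [← sum_coordL w]
    simp only [map_sum, map_smul, smul_eq_mul, FunLike.coe_sum, Finset.sum_apply, smul_apply,
      mul_comm]
  conv_lhs => rw [← (hG.invertible hp).inverse_apply_self v, h]
  simp only [map_sum, map_smul, invMetric, smul_eq_mul, mul_comm]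

/-- The trace as a contraction with the inverse metric. -/
theorem trL_eq (hG : IsMetricFamily U G) (hp : p ∈ cyl U) (A : E →L[ℝ] E) :
    trL E A = ∑ i, ∑ j, invMetric G i j p *
      G p (A (Module.finBasis ℝ E i)) (Module.finBasis ℝ E j) := by
  rw [trL_eq_sum]
  exact Finset.sum_congr rfl fun i _ => hG.coordL_eq_sum hp i _

/-- In the contraction of g(A eᵢ, eⱼ) with the inverse metric, passing to the adjoint exchanges i
and j, and the inverse metric is symmetric. -/
theorem trL_adjoint (hG : IsMetricFamily U G) (hp : p ∈ cyl U) {A B : E →L[ℝ] E}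
    (h : ∀ v w, G p (A v) w = G p v (B w)) : trL E A = trL E B := by
  rw [hG.trL_eq hp, hG.trL_eq hp, Finset.sum_comm]
  refine Finset.sum_congr rfl fun i _ => Finset.sum_congr rfl fun j _ => ?_
  rw [h, hG.invMetric_symm hp, hG.symm p hp]

theorem trL_skew (hG : IsMetricFamily U G) (hp : p ∈ cyl U) {A : E →L[ℝ] E}
    (h : ∀ v w, G p (A v) w = - G p v (A w)) : trL E A = 0 := by
  have := hG.trL_adjoint hp (A := A) (B := -A) fun v w => by rw [h]; simp
  rw [map_neg] at this
  linarith

theorem curvature_eq (hG : IsMetricFamily U G) (hp : p ∈ cyl U) (u v : E) :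
    curvature (fun z => G (p.1, z)) p.2 u v = curv G u v p := by
  have h := fun a b => fderiv_slice ((hG.smooth_gam a).differentiableAt (p := (p.1, p.2)) hp) b
  simp only [curvature, curv]
  rw [← h, ← h]
  rfl

theorem curv_add (hG : IsMetricFamily U G) (hp : p ∈ cyl U) (u u' v : E) :
    curv G (u + u') v p = curv G u v p + curv G u' v p := by
  have h : gam G (u + u') = fun q => gam G u q + gam G u' q := by
    ext1 q; exact christoffel_add _ _ _ _
  simp only [curv, sd_add, h, sd, pd_add _ (hG.smooth_gam u) (hG.smooth_gam u') hp]
  noncomm_ring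

theorem curv_smul (hG : IsMetricFamily U G) (hp : p ∈ cyl U) (a : ℝ) (u v : E) :
    curv G (a • u) v p = a • curv G u v p := by
  have h : gam G (a • u) = fun q => a • gam G u q := by
    ext1 q; exact christoffel_smul _ _ _ _
  simp only [curv, sd_smul, h, sd, pd_const_smul _ _ (hG.smooth_gam u) hp, smul_mul_assoc,
    mul_smul_comm, smul_add, smul_sub]

/-- The linear map `u ↦ R (u, v) w`. -/
def curvMap (hG : IsMetricFamily U G) (hp : p ∈ cyl U) (v w : E) : E →L[ℝ] E :=
  LinearMap.toContinuousLinearMap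
    { toFun := fun u => curv G u v p w
      map_add' := fun u u' => by rw [hG.curv_add hp]; rfl
      map_smul' := fun a u => by rw [hG.curv_smul hp]; rfl }

theorem curvMap_apply (hG : IsMetricFamily U G) (hp : p ∈ cyl U) (v w u : E) :
    hG.curvMap hp v w u = curv G u v p w := rfl

theorem ric_eq_trL (hG : IsMetricFamily U G) (hp : p ∈ cyl U) (v w : E) :
    ric G p v w = trL E (hG.curvMap hp v w) := by
  refine ricci_apply _ _ (fun u => ?_) v w _ fun u => ?_
  · exact (hasFDerivAt_slice
      ((hG.smooth_gam u).differentiableAt (p := (p.1, p.2)) hp)).differentiableAt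
  · rw [hG.curvature_eq hp]; rfl

theorem ric_eq_sum (hG : IsMetricFamily U G) (hp : p ∈ cyl U) (v w : E) :
    ric G p v w = ∑ i, coordL i (curv G (Module.finBasis ℝ E i) v p w) := by
  rw [hG.ric_eq_trL hp, trL_eq_sum]; rfl

theorem smooth_ric (hG : IsMetricFamily U G) : SmoothOn (cyl U) (ric G) := by
  have h : SmoothOn (cyl U) (fun p => bilOf fun v => ∑ i, (coordL i).comp
      (curv G (Module.finBasis ℝ E i) v p)) :=
    smooth_bilOf hG.isOpen fun v => .sum hG.isOpen fun i _ =>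
      (SmoothOn.const hG.isOpen (coordL i)).comp (hG.smooth_curv _ v)
  refine h.congr fun p hp => ?_
  simp only [ric, ricci, hG.curvature_eq hp]

/-- By pair symmetry u ↦ R(u,v)w and u ↦ R(u,w)v are adjoint to each other, so their traces agree.
-/
theorem ric_symm (hG : IsMetricFamily U G) (hp : p ∈ cyl U) (v w : E) :
    ric G p v w = ric G p w v := by
  rw [hG.ric_eq_trL hp, hG.ric_eq_trL hp]
  refine hG.trL_adjoint hp fun a b => ?_
  rw [curvMap_apply, curvMap_apply, hG.curv_pair_symm hp, hG.symm p hp a, curv_antisymm]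
  simp only [neg_apply, map_neg]
  rw [hG.curv_skew hp, neg_neg, hG.symm p hp]

/-- If a self-adjoint endomorphism `A` commutes with the curvature, then
`R (A v, w) = R (v, A w)`. -/
theorem curv_slide (hG : IsMetricFamily U G) (hp : p ∈ cyl U) {A : E →L[ℝ] E}
    (hA : ∀ v w, G p (A v) w = G p v (A w)) (hc : ∀ u v, Commute (curv G u v p) A) (v w : E) :
    curv G (A v) w p = curv G v (A w) p := by
  refine hG.end_ext hp fun a b => ?_
  have h := congrArg (fun L : E →L[ℝ] E => L v) (hc a b).eq
  simp only [mul_apply_eq_comp] at h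
  -- Pair symmetry carries A from the form slots to the vector on which the curvature acts, where
  -- the two commute, and back.
  rw [hG.curv_pair_symm hp, h, hA, hG.curv_pair_symm hp]

/-- A self-adjoint endomorphism commuting with the curvature is symmetric for the Ricci tensor. -/
theorem ric_slide (hG : IsMetricFamily U G) (hp : p ∈ cyl U) {A : E →L[ℝ] E}
    (hA : ∀ v w, G p (A v) w = G p v (A w)) (hc : ∀ u v, Commute (curv G u v p) A) (v w : E) :
    ric G p (A v) w = ric G p v (A w) := by
  -- With M = (u ↦ R(u,v)w), sliding A gives MA on one side and commuting it past R gives AM on the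
  -- other; the traces coincide.
  have h1 : hG.curvMap hp (A v) w = hG.curvMap hp v w * A := by
    ext u
    rw [mul_apply_eq_comp, curvMap_apply, curvMap_apply, hG.curv_slide hp hA hc]
  have h2 : hG.curvMap hp v (A w) = A * hG.curvMap hp v w := by
    ext u
    have h := congrArg (fun L : E →L[ℝ] E => L w) (hc u v).eq
    simp only [mul_apply_eq_comp] at h ⊢
    rw [curvMap_apply, h, curvMap_apply]
  rw [hG.ric_eq_trL hp, hG.ric_eq_trL hp, h1, h2, trL_mul_comm]

theorem smooth_velocity (hG : IsMetricFamily U G) : SmoothOn (cyl U) (velocity G) :=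
  hG.smooth_raise (hG.smooth.pd _)

theorem velocity_spec (hG : IsMetricFamily U G) (hp : p ∈ cyl U) (v w : E) :
    G p (velocity G p v) w = td G p v w := hG.raise_spec hp _ v w

theorem velocity_selfAdjoint (hG : IsMetricFamily U G) (hp : p ∈ cyl U) (v w : E) :
    G p (velocity G p v) w = G p v (velocity G p w) := by
  rw [hG.symm p hp v, hG.velocity_spec hp, hG.velocity_spec hp, hG.sd_symm hp]

theorem cd_velocity_selfAdjoint (hG : IsMetricFamily U G) (hp : p ∈ cyl U) (ξ v w : E) :
    G p (cd G ξ (velocity G) p v) w = G p v (cd G ξ (velocity G) p w) :=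
  hG.cd_selfAdjoint hG.smooth_velocity (fun _ hq => hG.velocity_selfAdjoint hq) ξ hp v w

/-- Time derivative of the metric pairing. -/
theorem td_pairing (hG : IsMetricFamily U G) (hp : p ∈ cyl U) {A B : ℝ × E → E}
    (hA : SmoothOn (cyl U) A) (hB : SmoothOn (cyl U) B) :
    td (fun q => G q (A q) (B q)) p =
      G p (velocity G p (A p)) (B p) + G p (td A p) (B p) + G p (A p) (td B p) := by
  rw [td, pd_apply₂ _ hG.smooth hA hB hp, ← td, hG.velocity_spec hp]

/-- The variation of the Levi-Civita connection along a variation satisfying the Codazzi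
equation. -/
theorem td_gam (hG : IsMetricFamily U G) (hp : p ∈ cyl U)
    (hW : ∀ ξ η, cd G ξ (velocity G) p η = cd G η (velocity G) p ξ) (ξ : E) :
    td (gam G ξ) p = (1 / 2 : ℝ) • cd G ξ (velocity G) p := by
  refine hG.end_ext hp fun η ζ => ?_
  have hc := fun v : E => SmoothOn.const hG.isOpen v
  have hWs := hG.smooth_velocity
  -- Time and space derivatives commute, so this is ∂_a of g(Wb,c), expanded by metric
  -- compatibility.
  have key : ∀ a b c, td (fun q => sd a G q b c) p = G p (cd G a (velocity G) p b) c
      + G p (velocity G p (gam G a p b)) c + G p (velocity G p b) (gam G a p c) := by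
    intro a b c
    have h1 : td (fun q => sd a G q b c) p = sd a (fun q => G q (velocity G q b) c) p := by
      have hb := hG.smooth.apply_const b
      have h2 : EqOn (fun q => sd a G q b c) (sd a (fun q => G q b c)) (cyl U) := fun q hq => by
        simp only [sd]
        rw [pd_apply_const _ hb c hq, pd_apply_const _ hG.smooth b hq]
      rw [td, pd_congr hG.isOpen h2 _ hp, sd, pd_comm _ _ (hb.apply_const c) hp]
      refine pd_congr hG.isOpen (fun q hq => ?_) _ hp
      rw [pd_apply_const _ hb c hq, pd_apply_const _ hG.smooth b hq]
      exact (hG.velocity_spec hq b c).symm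
    rw [h1, hG.sd_pairing hp a (hWs.apply_const b) (hc c)]
    simp only [sd, pd_const, zero_add, pd_apply_const _ hWs _ hp, cd, add_apply, sub_apply,
      mul_apply_eq_comp, map_add, map_sub]
    ring
  have h1 : td (fun q => G q (gam G ξ q η) ζ) p = (1 / 2) * (td (fun q => sd ξ G q η ζ) p
      + td (fun q => sd η G q ξ ζ) p - td (fun q => sd ζ G q ξ η) p) := by
    have hs : ∀ a b c, SmoothOn (cyl U) (fun q => sd a G q b c) := fun a b c =>
      ((hG.smooth.pd _).apply_const b).apply_const c
    rw [td, pd_congr hG.isOpen (fun q hq => hG.gam_spec hq ξ η ζ) _ hp]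
    simp only [← smul_eq_mul]
    rw [pd_const_smul _ _ (((hs _ _ _).add (hs _ _ _)).sub (hs _ _ _)) hp,
      pd_sub _ ((hs _ _ _).add (hs _ _ _)) (hs _ _ _) hp, pd_add _ (hs _ _ _) (hs _ _ _) hp]
  rw [key, key, key, hG.td_pairing hp ((hG.smooth_gam ξ).apply_const η) (hc ζ)] at h1
  simp only [td, pd_const, map_zero, pd_apply_const _ (hG.smooth_gam ξ) _ hp, add_zero] at h1
  have e1 := hG.gam_symm hp ξ η
  have e2 := hG.gam_symm hp ζ ξ
  have e3 := hG.gam_symm hp ζ η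
  have e4 := hW η ξ
  -- The Codazzi equation and self-adjointness make g(∇_aW b, c) totally symmetric, so the three
  -- covariant terms of the Koszul formula collapse to one; the other terms cancel by
  -- torsion-freeness.
  have e5 : G p (cd G ζ (velocity G) p ξ) η = G p (cd G ξ (velocity G) p η) ζ := by
    rw [hW ζ ξ, hG.cd_velocity_selfAdjoint hp, hG.symm p hp]
  have e6 := hG.velocity_selfAdjoint hp (gam G ξ p ζ) η
  have e7 := hG.symm p hp (gam G ξ p ζ) (velocity G p η)
  rw [e2, e3, ← e1, e4, e5] at h1
  simp only [smul_apply, map_smul, smul_eq_mul]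
  linarith

/-- The curvature of a family of metrics is constant in time if the variation satisfies the
Codazzi equation and commutes with the curvature. -/
theorem td_curv (hG : IsMetricFamily U G)
    (hW : ∀ p ∈ cyl U, ∀ ξ η, cd G ξ (velocity G) p η = cd G η (velocity G) p ξ)
    (hp : p ∈ cyl U) (hR : ∀ u v, Commute (curv G u v p) (velocity G p)) (ξ η : E) :
    td (curv G ξ η) p = 0 := by
  have hg := hG.smooth_gam
  have hWs := hG.smooth_velocity
  have h1 : ∀ a b, td (sd a (gam G b)) p = (1 / 2 : ℝ) • sd a (cd G b (velocity G)) p :=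
    fun a b => by
      rw [td, sd, pd_comm _ _ (hg b) hp,
        pd_congr hG.isOpen (fun q hq => hG.td_gam hq (hW q hq) b) _ hp,
        pd_const_smul _ _ (hG.smooth_cd hWs b) hp]
  -- The antisymmetrised second derivative of W is [R(ξ,η),W] = 0; by Γ̇ = ½∇W it is also twice the
  -- time derivative of R(ξ,η).
  have h2 := hG.ricci_identity hWs ξ η hp
  rw [(hR ξ η).eq, sub_self] at h2
  have h3 : td (curv G ξ η) p = (td (sd ξ (gam G η)) p - td (sd η (gam G ξ)) p)
      + ((td (gam G ξ) p * gam G η p + gam G ξ p * td (gam G η) p)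
        - (td (gam G η) p * gam G ξ p + gam G η p * td (gam G ξ) p)) := by
    simp only [td]
    rw [← pd_mul _ (hg ξ) (hg η) hp, ← pd_mul _ (hg η) (hg ξ) hp,
      ← pd_sub _ ((hg ξ).mul (hg η)) ((hg η).mul (hg ξ)) hp,
      ← pd_sub _ ((hg η).pd _) ((hg ξ).pd _) hp,
      ← pd_add _ (((hg η).pd _).sub ((hg ξ).pd _)) (((hg ξ).mul (hg η)).sub ((hg η).mul (hg ξ))) hp]
    rfl
  rw [h3, h1, h1, hG.td_gam hp (hW p hp), hG.td_gam hp (hW p hp)]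
  have h4 : cd G ξ (cd G η (velocity G)) p - cd G η (cd G ξ (velocity G)) p =
    (sd ξ (cd G η (velocity G)) p - sd η (cd G ξ (velocity G)) p) +
    ((cd G ξ (velocity G) p * gam G η p + gam G ξ p * cd G η (velocity G) p)
      - (cd G η (velocity G) p * gam G ξ p + gam G η p * cd G ξ (velocity G) p)) := by
    rw [cd, cd.eq_def G η (cd G ξ (velocity G))]
    noncomm_ring
  rw [h4] at h2
  have h5 := congrArg (fun A => (1 / 2 : ℝ) • A) h2
  simp only [smul_zero] at h5
  rw [← h5]
  simp only [smul_mul_assoc, mul_smul_comm, smul_add, smul_sub]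

/-- The trace defining the Ricci form does not involve the metric, so only the curvature gets
differentiated. -/
theorem td_ric (hG : IsMetricFamily U G) (hp : p ∈ cyl U)
    (h : ∀ u v, td (curv G u v) p = 0) : td (ric G) p = 0 := by
  ext v w
  rw [← pd_apply_const _ hG.smooth_ric v hp,
    ← pd_apply_const _ (hG.smooth_ric.apply_const v) w hp,
    pd_congr hG.isOpen (fun q hq => hG.ric_eq_sum hq v w) _ hp,
    pd_sum _ (fun i _ => ((hG.smooth_curv _ v).apply_const w).clm (coordL i)) hp]
  refine Finset.sum_eq_zero fun i _ => ?_
  have := h (Module.finBasis ℝ E i) v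
  rw [pd_clm _ (coordL i) ((hG.smooth_curv _ v).apply_const w) hp,
    pd_apply_const _ (hG.smooth_curv _ v) w hp, ← td, this]
  simp

end IsMetricFamily

end RicciTensor

/-! ### The algebra of fields whose covariant derivatives satisfy commutation conditions. -/

section CommutationConditions

variable {E : Type*} [NormedAddCommGroup E] [NormedSpace ℝ E]

/-- The field `F` of endomorphisms is smooth, and at the points of `S` its iterated covariant
derivatives of order at most `k` commute with all the fields `X i`. -/
def MemCentralizer {ι : Type*} (U : Set E) (G : ℝ × E → Bil E) (X : ι → ℝ × E → E →L[ℝ] E)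
    (S : Set (ℝ × E)) : ℕ → (ℝ × E → E →L[ℝ] E) → Prop
  | 0, F => SmoothOn (cyl U) F ∧ ∀ p ∈ S, ∀ i, Commute (X i p) (F p)
  | k + 1, F => (SmoothOn (cyl U) F ∧ ∀ p ∈ S, ∀ i, Commute (X i p) (F p)) ∧
      ∀ ξ, MemCentralizer U G X S k (cd G ξ F)

namespace MemCentralizer

variable [FiniteDimensional ℝ E] {ι : Type*} {U : Set E} {G : ℝ × E → Bil E}
  {X : ι → ℝ × E → E →L[ℝ] E} {S S' : Set (ℝ × E)} {k : ℕ} {F F' : ℝ × E → E →L[ℝ] E}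

theorem zero_level (h : MemCentralizer U G X S k F) : MemCentralizer U G X S 0 F := by
  cases k with
  | zero => exact h
  | succ k => exact h.1

theorem smooth (h : MemCentralizer U G X S k F) : SmoothOn (cyl U) F := h.zero_level.1

theorem commute (h : MemCentralizer U G X S k F) {p : ℝ × E} (hp : p ∈ S) (i : ι) :
    Commute (X i p) (F p) := h.zero_level.2 p hp i

theorem cd (h : MemCentralizer U G X S (k + 1) F) (ξ : E) :
    MemCentralizer U G X S k (cd G ξ F) := h.2 ξ

theorem of_succ (h : MemCentralizer U G X S (k + 1) F) : MemCentralizer U G X S k F := by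
  induction k generalizing F with
  | zero => exact h.1
  | succ k ih => exact ⟨h.1, fun ξ => ih (h.2 ξ)⟩

theorem congr (hG : IsMetricFamily U G) (hS : S ⊆ cyl U) (h : MemCentralizer U G X S k F)
    (h' : EqOn F' F (cyl U)) : MemCentralizer U G X S k F' := by
  induction k generalizing F F' with
  | zero => exact ⟨h.1.congr h', fun p hp i => by rw [h' (hS hp)]; exact h.2 p hp i⟩
  | succ k ih =>
    exact ⟨⟨h.1.1.congr h', fun p hp i => by rw [h' (hS hp)]; exact h.1.2 p hp i⟩,
      fun ξ => ih (h.2 ξ) (hG.cd_eqOn h' ξ)⟩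

theorem add (hG : IsMetricFamily U G) (hS : S ⊆ cyl U) (h : MemCentralizer U G X S k F)
    (h' : MemCentralizer U G X S k F') : MemCentralizer U G X S k (fun q => F q + F' q) := by
  induction k generalizing F F' with
  | zero => exact ⟨h.1.add h'.1, fun p hp i => (h.2 p hp i).add_right (h'.2 p hp i)⟩
  | succ k ih =>
    exact ⟨⟨h.1.1.add h'.1.1, fun p hp i => (h.1.2 p hp i).add_right (h'.1.2 p hp i)⟩, fun ξ =>
      (ih (h.2 ξ) (h'.2 ξ)).congr hG hS fun p hp => cd_add h.1.1 h'.1.1 ξ hp⟩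

/-- Closure under function coefficients reconciles derivatives in constant directions with tensorial
ones: the Christoffel corrections are combinations of lower derivatives with function coefficients.
-/
theorem smul (hG : IsMetricFamily U G) (hS : S ⊆ cyl U) {f : ℝ × E → ℝ}
    (hf : SmoothOn (cyl U) f) (h : MemCentralizer U G X S k F) :
    MemCentralizer U G X S k (fun q => f q • F q) := by
  induction k generalizing f F with
  | zero => exact ⟨hf.smul h.1, fun p hp i => (h.2 p hp i).smul_right _⟩
  | succ k ih =>
    exact ⟨⟨hf.smul h.1.1, fun p hp i => (h.1.2 p hp i).smul_right _⟩, fun ξ =>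
      ((ih (hf.pd _) h.of_succ).add hG hS (ih hf (h.2 ξ))).congr hG hS
        fun p hp => cd_smul hf h.1.1 ξ hp⟩

theorem const_smul (hG : IsMetricFamily U G) (hS : S ⊆ cyl U) (a : ℝ)
    (h : MemCentralizer U G X S k F) : MemCentralizer U G X S k (fun q => a • F q) :=
  h.smul hG hS (.const hG.isOpen a)

theorem sub (hG : IsMetricFamily U G) (hS : S ⊆ cyl U) (h : MemCentralizer U G X S k F)
    (h' : MemCentralizer U G X S k F') : MemCentralizer U G X S k (fun q => F q - F' q) :=
  (h.add hG hS (h'.const_smul hG hS (-1))).congr hG hS fun p _ => by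
    simp [sub_eq_add_neg]

theorem mul (hG : IsMetricFamily U G) (hS : S ⊆ cyl U) (h : MemCentralizer U G X S k F)
    (h' : MemCentralizer U G X S k F') : MemCentralizer U G X S k (fun q => F q * F' q) := by
  induction k generalizing F F' with
  | zero => exact ⟨h.1.mul h'.1, fun p hp i => (h.2 p hp i).mul_right (h'.2 p hp i)⟩
  | succ k ih =>
    exact ⟨⟨h.1.1.mul h'.1.1, fun p hp i => (h.1.2 p hp i).mul_right (h'.1.2 p hp i)⟩, fun ξ =>
      ((ih (h.2 ξ) h'.of_succ).add hG hS (ih h.of_succ (h'.2 ξ))).congr hG hS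
        fun p hp => cd_mul h.1.1 h'.1.1 ξ hp⟩

theorem zero (hG : IsMetricFamily U G) (hS : S ⊆ cyl U) (k : ℕ) :
    MemCentralizer U G X S k (fun _ => 0) := by
  have h0 : SmoothOn (cyl U) (fun _ : ℝ × E => (0 : E →L[ℝ] E)) := .const hG.isOpen _
  induction k with
  | zero => exact ⟨h0, fun p _ i => Commute.zero_right _⟩
  | succ k ih =>
    refine ⟨⟨h0, fun p _ i => Commute.zero_right _⟩, fun ξ => ih.congr hG hS fun p _ => ?_⟩
    simp [ScatteringData.cd, pd_const]

theorem sum {κ : Type*} (s : Finset κ) (hG : IsMetricFamily U G) (hS : S ⊆ cyl U)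
    {A : κ → ℝ × E → E →L[ℝ] E} (h : ∀ j ∈ s, MemCentralizer U G X S k (A j)) :
    MemCentralizer U G X S k (fun q => ∑ j ∈ s, A j q) := by
  classical
  induction s using Finset.induction_on with
  | empty => simpa using zero hG hS k
  | insert a s ha ih =>
    simp only [Finset.sum_insert ha]
    exact (h a (Finset.mem_insert_self a s)).add hG hS
      (ih fun j hj => h j (Finset.mem_insert_of_mem hj))

/-- Covariant derivative along a smooth vector field. -/
theorem cd_along (hG : IsMetricFamily U G) (hS : S ⊆ cyl U)
    (h : MemCentralizer U G X S (k + 1) F) {N : ℝ × E → E} (hN : SmoothOn (cyl U) N) :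
    MemCentralizer U G X S k (fun q => ScatteringData.cd G (N q) F q) := by
  refine (sum Finset.univ hG hS fun j _ => (h.cd (Module.finBasis ℝ E j)).smul hG hS
    (hN.clm (coordL j))).congr hG hS fun p _ => ?_
  have : cdLin G F p (N p) = cdLin G F p (∑ j, coordL j (N p) • Module.finBasis ℝ E j) := by
    rw [sum_coordL]
  rw [map_sum] at this
  simp only [map_smul] at this
  exact this

end MemCentralizer

section Iterated

variable [FiniteDimensional ℝ E] {U : Set E} {G : ℝ × E → Bil E}

/-- The iterated covariant derivatives of a family of fields of endomorphisms. -/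
def iterCd (G : ℝ × E → Bil E) (F : ℝ × E → E →L[ℝ] E) (n : ℕ) (ξ : Fin n → E) (q : ℝ × E) :
    E →L[ℝ] E :=
  iterCovDeriv (fun z => G (q.1, z)) (fun z => F (q.1, z)) n q.2 ξ

/-- Contraction of a multilinear map with an endomorphism acting as a derivation. -/
def multilinearDerivation {n : ℕ} {V : Type*} [AddCommGroup V] [Module ℝ V]
    (m : MultilinearMap ℝ (fun _ : Fin n => E) V) (T : E →L[ℝ] E) :
    MultilinearMap ℝ (fun _ : Fin n => E) V where
  toFun v := ∑ i, m (Function.update v i (T (v i)))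
  map_update_add' {inst} v j x y := by
    obtain rfl : inst = instDecidableEqFin n := Subsingleton.elim _ _
    rw [← Finset.sum_add_distrib]
    refine Finset.sum_congr rfl fun i _ => ?_
    by_cases h : i = j
    · subst h; simp
    · simp only [Function.update_of_ne h, Function.update_comm (Ne.symm h), m.map_update_add]
  map_update_smul' {inst} v j a x := by
    obtain rfl : inst = instDecidableEqFin n := Subsingleton.elim _ _
    rw [Finset.smul_sum]
    refine Finset.sum_congr rfl fun i _ => ?_
    by_cases h : i = j
    · subst h; simp
    · simp only [Function.update_of_ne h, Function.update_comm (Ne.symm h), m.map_update_smul]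

theorem MultilinearMap.update_expand {n : ℕ} {V : Type*} [AddCommGroup V] [Module ℝ V]
    (m : MultilinearMap ℝ (fun _ : Fin n => E) V) (v : Fin n → E) (i : Fin n) (w : E) :
    m (Function.update v i w) =
      ∑ j, coordL j w • m (Function.update v i (Module.finBasis ℝ E j)) := by
  conv_lhs => rw [← sum_coordL w]
  rw [m.map_update_sum]
  simp only [m.map_update_smul]

theorem iterCd_succ {F : ℝ × E → E →L[ℝ] E} {n : ℕ} (ξ : Fin (n + 1) → E)
    (hs : SmoothOn (cyl U) (iterCd G F n (Fin.tail ξ))) {q : ℝ × E} (hq : q ∈ cyl U) :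
    iterCd G F (n + 1) ξ q = cd G (ξ 0) (iterCd G F n (Fin.tail ξ)) q -
      ∑ i, iterCd G F n (Function.update (Fin.tail ξ) i (gam G (ξ 0) q (Fin.tail ξ i))) q := by
  have h := fderiv_slice (hs.differentiableAt (p := (q.1, q.2)) hq) (ξ 0)
  rw [cd, ← h]
  rfl

/-- Smoothness and multilinearity are proved in one induction: smoothness at the next order needs
the moving arguments Γ(ξ₀,ξᵢ) expanded in the fixed basis, which uses multilinearity one order
below. -/
theorem iterCd_smooth_multilinear (hG : IsMetricFamily U G) {F : ℝ × E → E →L[ℝ] E}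
    (hF : SmoothOn (cyl U) F) (n : ℕ) :
    (∀ ξ, SmoothOn (cyl U) (iterCd G F n ξ)) ∧
      ∃ m : ℝ × E → MultilinearMap ℝ (fun _ : Fin n => E) (E →L[ℝ] E),
        ∀ q ∈ cyl U, ∀ ξ, iterCd G F n ξ q = m q ξ := by
  induction n with
  | zero =>
    exact ⟨fun ξ => hF, fun q => MultilinearMap.constOfIsEmpty ℝ _ (F q), fun q _ ξ => rfl⟩
  | succ n ih =>
    obtain ⟨hs, m, hm⟩ := ih
    constructor
    · intro ξ
      refine ((hG.smooth_cd (hs (Fin.tail ξ)) (ξ 0)).sub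
        (.sum (s := Finset.univ) hG.isOpen fun i _ => .sum (s := Finset.univ) hG.isOpen fun j _ =>
          (((hG.smooth_gam (ξ 0)).apply_const (Fin.tail ξ i)).clm
          (coordL j)).smul (hs (Function.update (Fin.tail ξ) i (Module.finBasis ℝ E j))))).congr
            fun q hq => ?_
      rw [iterCd_succ ξ (hs _) hq]
      simp only [hm q hq]
      refine congrArg _ (Finset.sum_congr rfl fun i _ => ?_)
      exact MultilinearMap.update_expand _ _ _ _
    · have hcd : ∀ q ∈ cyl U, ∀ a, ∃ c : MultilinearMap ℝ (fun _ : Fin n => E) (E →L[ℝ] E),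
          ∀ v, c v = cd G a (iterCd G F n v) q := fun q hq a => by
        refine ⟨⟨fun v => cd G a (iterCd G F n v) q, fun {inst} v i x y => ?_,
          fun {inst} v i r x => ?_⟩, fun v => rfl⟩
        · obtain rfl : inst = instDecidableEqFin n := Subsingleton.elim _ _
          rw [← cd_add (hs _) (hs _) a hq]
          exact hG.cd_eqOn (fun z hz => by simp only [hm z hz, (m z).map_update_add]) a hq
        · obtain rfl : inst = instDecidableEqFin n := Subsingleton.elim _ _
          have := cd_smul (G := G) (.const hG.isOpen r) (hs (Function.update v i x)) a hq
          rw [sd, pd_const, zero_smul, zero_add] at this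
          rw [← this]
          exact hG.cd_eqOn (fun z hz => by simp only [hm z hz, (m z).map_update_smul]) a hq
      have : ∀ q, ∃ m' : MultilinearMap ℝ (fun _ : Fin (n + 1) => E) (E →L[ℝ] E),
          q ∈ cyl U → ∀ ξ, iterCd G F (n + 1) ξ q = m' ξ := fun q => by
        by_cases hq : q ∈ cyl U
        · choose c hc using hcd q hq
          let L : E →ₗ[ℝ] MultilinearMap ℝ (fun _ : Fin n => E) (E →L[ℝ] E) :=
            { toFun := fun a => c a - multilinearDerivation (m q) (gam G a q)
              map_add' := fun a b => by
                ext1 v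
                have h1 : gam G (a + b) q = gam G a q + gam G b q := christoffel_add _ _ _ _
                simp only [sub_apply, hc, cd_add_dir,
                  multilinearDerivation, MultilinearMap.coe_mk, h1, add_apply,
                  MultilinearMap.map_update_add, Finset.sum_add_distrib]
                abel
              map_smul' := fun r a => by
                ext1 v
                have h1 : gam G (r • a) q = r • gam G a q := christoffel_smul _ _ _ _
                simp only [sub_apply, hc, cd_smul_dir,
                  multilinearDerivation, MultilinearMap.coe_mk, h1, smul_apply,
                  MultilinearMap.map_update_smul, ← Finset.smul_sum, smul_sub, RingHom.id_apply] }
          refine ⟨L.uncurryLeft, fun _ ξ => ?_⟩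
          rw [iterCd_succ ξ (hs _) hq]
          simp only [hm q hq, LinearMap.uncurryLeft_apply]
          change _ = c (ξ 0) (Fin.tail ξ) - multilinearDerivation (m q) _ (Fin.tail ξ)
          rw [hc]
          rfl
        -- Off the cylinder nothing is required of the multilinear map.
        · exact ⟨0, fun h => absurd h hq⟩
      choose m' hm' using this
      exact ⟨m', hm'⟩

theorem iterCd_update_expand (hG : IsMetricFamily U G) {F : ℝ × E → E →L[ℝ] E}
    (hF : SmoothOn (cyl U) F) {n : ℕ} (v : Fin n → E) (i : Fin n) (w : E) {q : ℝ × E}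
    (hq : q ∈ cyl U) : iterCd G F n (Function.update v i w) q =
      ∑ j, coordL j w • iterCd G F n (Function.update v i (Module.finBasis ℝ E j)) q := by
  obtain ⟨-, m, hm⟩ := iterCd_smooth_multilinear hG hF n
  simp only [hm q hq]
  exact MultilinearMap.update_expand _ _ _ _

variable {ι : Type*} {X : ι → ℝ × E → E →L[ℝ] E} {S : Set (ℝ × E)} {F : ℝ × E → E →L[ℝ] E}

/-- These sums are the difference between ∇_a(∇ⁿF(v)) and ∇ⁿ⁺¹F(a,v). Their arguments vary with the
point, so they are rewritten over the fixed basis. -/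
theorem MemCentralizer.sum_iterCd (hG : IsMetricFamily U G) (hS : S ⊆ cyl U)
    (hF : SmoothOn (cyl U) F) {n k : ℕ} (h : ∀ ξ, MemCentralizer U G X S k (iterCd G F n ξ))
    (a : E) (v : Fin n → E) : MemCentralizer U G X S k
      (fun q => ∑ i, iterCd G F n (Function.update v i (gam G a q (v i))) q) := by
  refine (sum Finset.univ hG hS fun i _ => sum Finset.univ hG hS fun j _ =>
    (h (Function.update v i (Module.finBasis ℝ E j))).smul hG hS
      (((hG.smooth_gam a).apply_const (v i)).clm (coordL j))).congr hG hS fun q hq => ?_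
  exact Finset.sum_congr rfl fun i _ => iterCd_update_expand hG hF _ _ _ hq

/-- The commutation conditions may be tested on the iterated covariant derivatives. -/
theorem memCentralizer_of_iterCd (hG : IsMetricFamily U G) (hS : S ⊆ cyl U)
    (hF : SmoothOn (cyl U) F)
    (h : ∀ n ξ, ∀ q ∈ S, ∀ i, Commute (X i q) (iterCd G F n ξ q)) (k : ℕ) :
    MemCentralizer U G X S k F := by
  have hs := fun n => (iterCd_smooth_multilinear hG hF n).1
  -- All orders n are treated at once, since raising k by one consumes one more iterated derivative.
  suffices H : ∀ n ξ, MemCentralizer U G X S k (iterCd G F n ξ) from H 0 ![]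
  induction k with
  | zero => exact fun n ξ => ⟨hs n ξ, h n ξ⟩
  | succ k ih =>
    refine fun n ξ => ⟨⟨hs n ξ, h n ξ⟩, fun a => ?_⟩
    refine ((ih (n + 1) (Fin.cons a ξ)).add hG hS
      (MemCentralizer.sum_iterCd hG hS hF (ih n) a ξ)).congr hG hS fun q hq => ?_
    rw [iterCd_succ _ (hs n _) hq, Fin.tail_cons, Fin.cons_zero, sub_add_cancel]

/-- The converse of `memCentralizer_of_iterCd`, from the same recursion solved for the newest
derivative; each order uses up one level, hence the hypothesis for all k. -/
theorem MemCentralizer.iterCd (hG : IsMetricFamily U G) (hS : S ⊆ cyl U)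
    (h : ∀ k, MemCentralizer U G X S k F) (n : ℕ) :
    ∀ k ξ, MemCentralizer U G X S k (iterCd G F n ξ) := by
  have hF := (h 0).smooth
  induction n with
  | zero => exact fun k ξ => h k
  | succ n ih =>
    intro k ξ
    exact (((ih (k + 1) (Fin.tail ξ)).cd (ξ 0)).sub hG hS
      (MemCentralizer.sum_iterCd hG hS hF (ih k) (ξ 0) (Fin.tail ξ))).congr hG hS fun q hq =>
        iterCd_succ ξ (ih 0 _).smooth hq

end Iterated

end CommutationConditions

/-! ### Propagation of commutation conditions along the flow. -/

section Propagation

variable {E : Type*} [NormedAddCommGroup E] [NormedSpace ℝ E] [FiniteDimensional ℝ E]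
  {ι : Type*} {U : Set E} {G : ℝ × E → Bil E} {X : ι → ℝ × E → E →L[ℝ] E} {p : ℝ × E}

/-- A family of metrics whose velocity is a Codazzi tensor all of whose covariant derivatives
commute with the fields `X i`; these comprise the curvature, they are constant in time, and their
centralizer is commutative. -/
structure IsScatteringFlow (U : Set E) (G : ℝ × E → Bil E) (X : ι → ℝ × E → E →L[ℝ] E) :
    Prop extends IsMetricFamily U G where
  codazzi : ∀ p ∈ cyl U, ∀ ξ η, cd G ξ (velocity G) p η = cd G η (velocity G) p ξ
  mem : ∀ k, MemCentralizer U G X (cyl U) k (velocity G)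
  time_const : ∀ i, ∀ p ∈ cyl U, X i p = X i (0, p.2)
  curv_mem : ∀ u v, ∃ i, ∀ p ∈ cyl U, X i p = curv G u v p
  comm : ∀ A B, MemCentralizer U G X (cyl U) 0 A → MemCentralizer U G X (cyl U) 0 B →
    ∀ p ∈ cyl U, Commute (A p) (B p)

/-- The initial slice of the space-time cylinder. -/
abbrev slice0 (U : Set E) : Set (ℝ × E) := ({0} : Set ℝ) ×ˢ U

namespace IsScatteringFlow

theorem commute_curv (h : IsScatteringFlow U G X) (hp : p ∈ cyl U) {F : ℝ × E → E →L[ℝ] E}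
    {k : ℕ} (hF : MemCentralizer U G X (cyl U) k F) (u v : E) :
    Commute (curv G u v p) (F p) := by
  obtain ⟨i, hi⟩ := h.curv_mem u v
  rw [← hi p hp]
  exact hF.commute hp i

theorem td_gam (h : IsScatteringFlow U G X) (hp : p ∈ cyl U) (ξ : E) :
    td (gam G ξ) p = (1 / 2 : ℝ) • cd G ξ (velocity G) p :=
  h.toIsMetricFamily.td_gam hp (h.codazzi p hp) ξ

theorem td_curv (h : IsScatteringFlow U G X) (hp : p ∈ cyl U) (u v : E) :
    td (curv G u v) p = 0 :=
  h.toIsMetricFamily.td_curv h.codazzi hp (h.commute_curv hp (h.mem 0)) u v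

theorem td_ric (h : IsScatteringFlow U G X) (hp : p ∈ cyl U) : td (ric G) p = 0 :=
  h.toIsMetricFamily.td_ric hp (h.td_curv hp)

/-- The two sides differ by ½[∇_ξW, F], which vanishes because the centralizer is commutative. -/
theorem td_cd (h : IsScatteringFlow U G X) {F : ℝ × E → E →L[ℝ] E}
    (hF : MemCentralizer U G X (cyl U) 0 F) (hp : p ∈ cyl U) (ξ : E) :
    td (cd G ξ F) p = cd G ξ (td F) p := by
  have hg := h.smooth_gam ξ
  have hFs := hF.smooth
  have h1 : td (cd G ξ F) p = td (sd ξ F) p + ((td (gam G ξ) p * F p + gam G ξ p * td F p)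
      - (td F p * gam G ξ p + F p * td (gam G ξ) p)) := by
    simp only [td]
    rw [← pd_mul _ hFs hg hp, ← pd_mul _ hg hFs hp, ← pd_sub _ (hg.mul hFs) (hFs.mul hg) hp,
      ← pd_add _ (hFs.pd _) ((hg.mul hFs).sub (hFs.mul hg)) hp]
    rfl
  have h2 := (h.comm _ _ ((h.mem 1).cd ξ) hF p hp).eq
  rw [h1, h.td_gam hp, cd.eq_def G ξ (td F), sd, td, pd_comm _ _ hFs hp, smul_mul_assoc,
    mul_smul_comm, h2]
  abel

/-- The commutation conditions propagate along linear evolution equations whose coefficients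
satisfy them. -/
theorem propagate (h : IsScatteringFlow U G X) {k : ℕ} {F Q : ℝ × E → E →L[ℝ] E}
    (hFs : SmoothOn (cyl U) F) (hQ : MemCentralizer U G X (cyl U) k Q)
    (hF : ∀ p ∈ cyl U, td F p = Q p - velocity G p * F p)
    (h0 : MemCentralizer U G X (slice0 U) k F) : MemCentralizer U G X (cyl U) k F := by
  have hG := h.toIsMetricFamily
  have base : ∀ F Q : ℝ × E → E →L[ℝ] E, SmoothOn (cyl U) F →
      MemCentralizer U G X (cyl U) 0 Q → (∀ p ∈ cyl U, td F p = Q p - velocity G p * F p) →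
      MemCentralizer U G X (slice0 U) 0 F → MemCentralizer U G X (cyl U) 0 F := by
    intro F Q hFs hQ hF h0
    refine ⟨hFs, fun p hp i => ?_⟩
    set A := X i p with hA
    have hAc : ∀ s, X i (s, p.2) = A := fun s => by
      rw [hA, h.time_const i p hp, h.time_const i (s, p.2) ⟨mem_univ _, hp.2⟩]
    refine hG.end_ext hp fun v w => ?_
    have hv : SmoothOn (cyl U) (fun q => A (F q v) - F q (A v)) :=
      ((hFs.apply_const v).clm A).sub (hFs.apply_const (A v))
    have hw : SmoothOn (cyl U) (fun _ => w) := .const hG.isOpen w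
    -- Since the time-independent A commutes with W and Q, the commutator C = [A,F] satisfies Ċ =
    -- −WC. The derivative of the metric contributes g(WCv,w), which cancels this exactly, so no
    -- uniqueness theorem for differential equations is needed.
    have hd : ∀ s, HasDerivAt (fun s => G (s, p.2) (A (F (s, p.2) v) - F (s, p.2) (A v)) w)
        0 s := fun s => by
      have hs : (s, p.2) ∈ cyl U := ⟨mem_univ _, hp.2⟩
      have h1 := hasDerivAt_time (((hG.smooth.apply hv).apply hw).differentiableAt hs)
      rw [hG.td_pairing hs hv hw] at h1
      have h2 : td (fun q => A (F q v) - F q (A v)) (s, p.2) =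
          A (td F (s, p.2) v) - td F (s, p.2) (A v) := by
        rw [td, pd_sub _ ((hFs.apply_const v).clm A) (hFs.apply_const (A v)) hs,
          pd_clm _ A (hFs.apply_const v) hs, pd_apply_const _ hFs _ hs, pd_apply_const _ hFs _ hs]
      have hWA : A * velocity G (s, p.2) = velocity G (s, p.2) * A := by
        rw [← hAc s]; exact ((h.mem 0).commute hs i).eq
      have hQA : A * Q (s, p.2) = Q (s, p.2) * A := by
        rw [← hAc s]; exact (hQ.commute hs i).eq
      have hWA' : ∀ x, A (velocity G (s, p.2) x) = velocity G (s, p.2) (A x) := fun x =>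
        congrArg (fun L : E →L[ℝ] E => L x) hWA
      have hQA' : ∀ x, A (Q (s, p.2) x) = Q (s, p.2) (A x) := fun x =>
        congrArg (fun L : E →L[ℝ] E => L x) hQA
      rw [h2, hF _ hs, td, pd_const] at h1
      refine h1.congr_deriv ?_
      simp only [sub_apply, mul_apply_eq_comp, map_sub, hWA', hQA', map_zero]
      ring
    have h1 := is_const_of_deriv_eq_zero (fun s => (hd s).differentiableAt)
      (fun s => (hd s).deriv) p.1 0
    have h2 := h0.commute (p := (0, p.2)) ⟨rfl, hp.2⟩ i
    rw [hAc] at h2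
    have h3 := congrArg (fun L : E →L[ℝ] E => L v) h2.eq
    simp only [mul_apply_eq_comp] at h3
    simp only [h3, sub_self, map_zero, zero_apply] at h1
    simp only [map_sub, sub_apply] at h1
    exact sub_eq_zero.1 h1
  induction k generalizing F Q with
  | zero => exact base F Q hFs hQ hF h0
  | succ k ih =>
    have hF0 := base F Q hFs hQ.zero_level hF h0.zero_level
    have hFk := ih hFs hQ.of_succ hF h0.of_succ
    -- ∇_ξF solves an equation of the same form with source ∇_ξQ − (∇_ξW)F; this source satisfies
    -- the conditions to order k because F already does, by `hFk`.
    refine ⟨hF0, fun ξ => ih (Q := fun q => cd G ξ Q q - cd G ξ (velocity G) q * F q)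
      (hG.smooth_cd hFs ξ) ?_ (fun q hq => ?_) (h0.cd ξ)⟩
    · exact (hQ.cd ξ).sub hG subset_rfl (((h.mem (k + 1)).cd ξ).mul hG subset_rfl hFk)
    · have hWs := hG.smooth_velocity
      rw [h.td_cd hF0 hq, hG.cd_eqOn hF ξ hq, cd_sub hQ.smooth (hWs.mul hFs) ξ hq,
        cd_mul hWs hFs ξ hq]
      abel

end IsScatteringFlow

/-! ### The Hessian of a time-dependent function. -/

section Hessian

/-- The spatial differential of a function. -/
def sgrad (f : ℝ × E → ℝ) (p : ℝ × E) : E →L[ℝ] ℝ :=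
  (fderiv ℝ f p).comp (ContinuousLinearMap.inr ℝ ℝ E)

/-- The Hessian of a family of functions. -/
def hess (G : ℝ × E → Bil E) (f : ℝ × E → ℝ) (p : ℝ × E) : Bil E :=
  hessian (fun z => G (p.1, z)) (fun z => f (p.1, z)) p.2

theorem sgrad_apply (f : ℝ × E → ℝ) (p : ℝ × E) (w : E) : sgrad f p w = sd w f p := by
  simp [sgrad, pd]

variable {f : ℝ × E → ℝ}

theorem smooth_sgrad (hf : SmoothOn (cyl U) f) : SmoothOn (cyl U) (sgrad f) :=
  hf.fderiv.comp (.const hf.1 _)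

theorem pd_sgrad (hf : SmoothOn (cyl U) f) (hp : p ∈ cyl U) (v : ℝ × E) (w : E) :
    pd v (sgrad f) p w = sd w (pd v f) p := by
  rw [← pd_apply_const _ (smooth_sgrad hf) w hp, sd, pd_comm _ _ hf hp]
  exact pd_congr hf.1 (fun q _ => sgrad_apply f q w) _ hp

namespace IsMetricFamily

theorem hess_eqOn (hG : IsMetricFamily U G) (hf : SmoothOn (cyl U) f) (hp : p ∈ cyl U) (u : E) :
    fderiv ℝ (fderiv ℝ (fun z => f (p.1, z))) p.2 u
      - fderiv ℝ (fun z => f (p.1, z)) p.2 ∘L christoffel (fun z => G (p.1, z)) p.2 u =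
    sd u (sgrad f) p - (sgrad f p).comp (gam G u p) := by
  have hU : IsOpen U := by
    have := hG.isOpen.preimage (Continuous.prodMk_right p.1)
    simpa [cyl, mk_preimage_prod_right] using this
  have h1 : EqOn (fderiv ℝ (fun z => f (p.1, z))) (fun z => sgrad f (p.1, z)) U := fun z hz =>
    (hasFDerivAt_slice (hf.differentiableAt (p := (p.1, z)) ⟨mem_univ _, hz⟩)).fderiv
  have h2 : fderiv ℝ (fun z => f (p.1, z)) =ᶠ[nhds p.2] fun z => sgrad f (p.1, z) := by
    filter_upwards [hU.mem_nhds hp.2] with z hz using h1 hz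
  rw [h2.fderiv_eq, h1 hp.2, fderiv_slice ((smooth_sgrad hf).differentiableAt (p := (p.1, p.2)) hp)]
  rfl

theorem hess_apply (hG : IsMetricFamily U G) (hf : SmoothOn (cyl U) f) (hp : p ∈ cyl U)
    (u v : E) : hess G f p u v = sd u (sd v f) p - sgrad f p (gam G u p v) := by
  have h := congrArg (fun L => L v) (hG.hess_eqOn hf hp u)
  rw [hess, hessian_apply]
  simp only [sub_apply, ContinuousLinearMap.comp_apply] at h
  rw [h, sd, pd_sgrad hf hp, sd, pd_comm _ _ hf hp]

theorem smooth_hess (hG : IsMetricFamily U G) (hf : SmoothOn (cyl U) f) :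
    SmoothOn (cyl U) (hess G f) := by
  have hs := smooth_sgrad hf
  refine (smooth_bilOf hG.isOpen (B := fun q u => sd u (sgrad f) q - (sgrad f q).comp (gam G u q))
    fun u => (hs.pd _).sub (hs.comp (hG.smooth_gam u))).congr fun p hp => ?_
  simp only [hess, hessian, hG.hess_eqOn hf hp]

theorem hess_symm (hG : IsMetricFamily U G) (hf : SmoothOn (cyl U) f) (hp : p ∈ cyl U)
    (u v : E) : hess G f p u v = hess G f p v u := by
  rw [hG.hess_apply hf hp, hG.hess_apply hf hp, sd, sd, pd_comm _ _ hf hp, hG.gam_symm hp]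

/-- The commutation formula for third derivatives of a function. -/
theorem hess_codazzi (hG : IsMetricFamily U G) (hf : SmoothOn (cyl U) f) (hp : p ∈ cyl U)
    (ξ η ζ : E) : (sd ξ (hess G f) p η ζ - hess G f p η (gam G ξ p ζ))
      - (sd η (hess G f) p ξ ζ - hess G f p ξ (gam G η p ζ)) = - sgrad f p (curv G ξ η p ζ) := by
  have hs := smooth_sgrad hf
  have hh := hG.smooth_hess hf
  -- The terms Hess(Γ(ξ,η),ζ) of the covariant derivative are symmetric in ξ and η, hence absent
  -- from the antisymmetrised statement. Third derivatives of f cancel, and the derivatives of Γ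
  -- assemble into curvature.
  have h : ∀ a b, sd a (hess G f) p b ζ = sd a (sd b (sd ζ f)) p
      - (sd (gam G b p ζ) (sd a f) p + sgrad f p (sd a (gam G b) p ζ)) := fun a b => by
    have hb := (hG.smooth_gam b).apply_const ζ
    simp only [sd]
    rw [← pd_apply_const _ hh b hp, ← pd_apply_const _ (hh.apply_const b) ζ hp,
      pd_congr hG.isOpen (fun q hq => hG.hess_apply hf hq b ζ) _ hp,
      pd_sub _ ((hf.pd _).pd _) (hs.apply hb) hp, pd_apply _ hs hb hp, pd_sgrad hf hp,
      pd_apply_const _ (hG.smooth_gam b) ζ hp]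
  rw [h, h, hG.hess_apply hf hp, hG.hess_apply hf hp]
  have e1 : ∀ a b, sd a (sd b f) p = sd b (sd a f) p := fun a b => pd_comm _ _ hf hp
  have e2 : sd ξ (sd η (sd ζ f)) p = sd η (sd ξ (sd ζ f)) p := pd_comm _ _ (hf.pd _) hp
  rw [e1 (gam G η p ζ), e1 (gam G ξ p ζ), e2]
  simp only [curv, add_apply, sub_apply, mul_apply_eq_comp, map_add, map_sub]
  ring

end IsMetricFamily

end Hessian

/-! ### Total symmetry of the second covariant derivative of the velocity. -/

section SecondDerivative

/-- The second covariant derivative of a field of endomorphisms. -/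
def cd2 (G : ℝ × E → Bil E) (F : ℝ × E → E →L[ℝ] E) (u v : E) (p : ℝ × E) : E →L[ℝ] E :=
  cd G u (cd G v F) p - cd G (gam G u p v) F p

namespace IsScatteringFlow

theorem cd2_mem (h : IsScatteringFlow U G X) {F : ℝ × E → E →L[ℝ] E} {k : ℕ}
    (hF : MemCentralizer U G X (cyl U) (k + 2) F) (u v : E) :
    MemCentralizer U G X (cyl U) k (cd2 G F u v) :=
  ((hF.cd v).cd u).sub h.toIsMetricFamily subset_rfl
    (hF.of_succ.cd_along h.toIsMetricFamily subset_rfl ((h.smooth_gam u).apply_const v))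

/-- The Ricci identity with [R,W] = 0. With `cd2_codazzi` and `cd2_selfAdjoint` it makes g(∇²_{u,v}W
a, b) totally symmetric. -/
theorem cd2_swap (h : IsScatteringFlow U G X) (hp : p ∈ cyl U) (u v : E) :
    cd2 G (velocity G) u v p = cd2 G (velocity G) v u p := by
  have h1 := h.ricci_identity h.smooth_velocity u v hp
  rw [(h.commute_curv hp (h.mem 0) u v).eq, sub_self, sub_eq_zero] at h1
  rw [cd2, cd2, h1, h.gam_symm hp]

theorem cd2_codazzi (h : IsScatteringFlow U G X) (hp : p ∈ cyl U) (u v w : E) :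
    cd2 G (velocity G) u v p w = cd2 G (velocity G) u w p v := by
  have hW := h.smooth_velocity
  have h1 : sd u (cd G v (velocity G)) p w = sd u (cd G w (velocity G)) p v := by
    rw [← pd_apply_const _ (h.smooth_cd hW v) w hp, ← pd_apply_const _ (h.smooth_cd hW w) v hp]
    exact pd_congr h.isOpen (fun q hq => h.codazzi q hq v w) _ hp
  rw [cd2, cd2, cd, cd.eq_def G u (cd G w (velocity G))]
  simp only [add_apply, sub_apply, mul_apply_eq_comp]
  rw [h1, h.codazzi p hp v w, h.codazzi p hp v (gam G u p w), h.codazzi p hp w (gam G u p v)]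
  abel

theorem cd2_selfAdjoint (h : IsScatteringFlow U G X) (hp : p ∈ cyl U) (u v a b : E) :
    G p (cd2 G (velocity G) u v p a) b = G p a (cd2 G (velocity G) u v p b) := by
  have h1 := h.cd_selfAdjoint (h.smooth_cd h.smooth_velocity v)
    (fun q hq => h.cd_velocity_selfAdjoint hq v) u hp a b
  have h2 := h.cd_velocity_selfAdjoint hp (gam G u p v) a b
  simp only [cd2, sub_apply, map_sub]
  rw [h1, h2]

/-- By total symmetry, the trace of the second covariant derivative of the velocity is its
rough Laplacian. -/
theorem trL_cd2 (h : IsScatteringFlow U G X) (hp : p ∈ cyl U) (u v : E) :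
    trL E (cd2 G (velocity G) u v p) = G p ((∑ i, ∑ j, invMetric G i j p •
      cd2 G (velocity G) (Module.finBasis ℝ E i) (Module.finBasis ℝ E j) p) u) v := by
  rw [h.trL_eq hp]
  simp only [FunLike.coe_sum, Finset.sum_apply, map_sum, smul_apply, map_smul, smul_eq_mul]
  refine Finset.sum_congr rfl fun i _ => Finset.sum_congr rfl fun j _ => ?_
  congr 1
  set a := Module.finBasis ℝ E i
  set b := Module.finBasis ℝ E j
  -- Transpositions of the four slots lead from (u,v,a,b) to (a,b,u,v).
  rw [h.cd2_codazzi hp u v a, h.cd2_swap hp u a, h.cd2_codazzi hp a u v, h.cd2_selfAdjoint hp,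
    h.cd2_codazzi hp a v b, h.symm p hp, h.cd2_selfAdjoint hp, h.symm p hp]

end IsScatteringFlow

end SecondDerivative

end Propagation

/-! ### Evolution of the Bakry-Emery-Ricci endomorphism and of its Codazzi defect. -/

section BakryEmery

variable {E : Type*} [NormedAddCommGroup E] [NormedSpace ℝ E] [FiniteDimensional ℝ E]
  {ι : Type*} {U : Set E} {G : ℝ × E → Bil E} {X : ι → ℝ × E → E →L[ℝ] E} {p : ℝ × E}
  {f : ℝ × E → ℝ}

/-- The tensor `Ric g + ∇ d f`. -/
def ber (G : ℝ × E → Bil E) (f : ℝ × E → ℝ) (p : ℝ × E) : Bil E := ric G p + hess G f p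

/-- The endomorphism corresponding to `Ric g + ∇ d f`. -/
def berEnd (G : ℝ × E → Bil E) (f : ℝ × E → ℝ) (p : ℝ × E) : E →L[ℝ] E :=
  raise (G p) (ber G f p)

/-- The drift Laplacian of the velocity. -/
def driftLaplacian (G : ℝ × E → Bil E) (f : ℝ × E → ℝ) (p : ℝ × E) : E →L[ℝ] E :=
  (1 / 2 : ℝ) • (∑ i, ∑ j, invMetric G i j p •
      cd2 G (velocity G) (Module.finBasis ℝ E i) (Module.finBasis ℝ E j) p
    - cd G (ContinuousLinearMap.inverse (G p) (sgrad f p)) (velocity G) p)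

namespace IsMetricFamily

theorem smooth_ber (hG : IsMetricFamily U G) (hf : SmoothOn (cyl U) f) :
    SmoothOn (cyl U) (ber G f) := hG.smooth_ric.add (hG.smooth_hess hf)

theorem smooth_berEnd (hG : IsMetricFamily U G) (hf : SmoothOn (cyl U) f) :
    SmoothOn (cyl U) (berEnd G f) := hG.smooth_raise (hG.smooth_ber hf)

theorem berEnd_spec (hG : IsMetricFamily U G) (hp : p ∈ cyl U) (v w : E) :
    G p (berEnd G f p v) w = ber G f p v w := hG.raise_spec hp _ v w

theorem ber_symm (hG : IsMetricFamily U G) (hf : SmoothOn (cyl U) f) (hp : p ∈ cyl U) (v w : E) :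
    ber G f p v w = ber G f p w v := by
  simp only [ber, add_apply]
  rw [hG.ric_symm hp, hG.hess_symm hf hp]

/-- The metric is parallel, so raising an index commutes with covariant differentiation. -/
theorem cd_raise (hG : IsMetricFamily U G) {B : ℝ × E → Bil E} (hB : SmoothOn (cyl U) B)
    (hp : p ∈ cyl U) (ξ η ζ : E) : G p (cd G ξ (fun q => raise (G q) (B q)) p η) ζ =
      sd ξ B p η ζ - B p (gam G ξ p η) ζ - B p η (gam G ξ p ζ) := by
  have hH := hG.smooth_raise hB
  have hc := fun v : E => SmoothOn.const hG.isOpen v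
  have h1 := pd_congr hG.isOpen (fun q hq => hG.raise_spec hq (B q) η ζ) (0, ξ) hp
  rw [← sd, hG.sd_pairing hp ξ (hH.apply_const η) (hc ζ),
    pd_apply_const _ (hB.apply_const η) ζ hp, pd_apply_const _ hB η hp, sd, sd, pd_const, zero_add,
    pd_apply_const _ hH η hp, hG.raise_spec hp] at h1
  simp only [cd, add_apply, sub_apply, mul_apply_eq_comp, map_add, map_sub] at h1 ⊢
  rw [hG.raise_spec hp _ (gam G ξ p η)]
  linarith

/-- The obstruction for `Ric g + ∇ d f` to be a Codazzi tensor. -/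
theorem berEnd_codazzi_defect (hG : IsMetricFamily U G) (hf : SmoothOn (cyl U) f)
    (hp : p ∈ cyl U) (ξ η ζ : E) :
    G p (cd G ξ (berEnd G f) p η - cd G η (berEnd G f) p ξ) ζ =
      (sd ξ (ric G) p η ζ - ric G p η (gam G ξ p ζ))
        - (sd η (ric G) p ξ ζ - ric G p ξ (gam G η p ζ)) - sgrad f p (curv G ξ η p ζ) := by
  have h1 := hG.cd_raise (hG.smooth_ber hf) hp ξ η ζ
  have h2 := hG.cd_raise (hG.smooth_ber hf) hp η ξ ζ
  have h3 := hG.hess_codazzi hf hp ξ η ζ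
  have h4 : ∀ a b, sd a (ber G f) p b ζ = sd a (ric G) p b ζ + sd a (hess G f) p b ζ :=
      fun a b => by
    have h5 : sd a (ber G f) p = sd a (ric G) p + sd a (hess G f) p :=
      pd_add _ hG.smooth_ric (hG.smooth_hess hf) hp
    rw [h5]; rfl
  rw [h4] at h1 h2
  rw [hG.gam_symm hp η ξ] at h2
  simp only [ber, add_apply] at h1 h2
  simp only [map_sub, sub_apply]
  change G p (cd G ξ (fun q => raise (G q) (ber G f q)) p η) ζ
    - G p (cd G η (fun q => raise (G q) (ber G f q)) p ξ) ζ = _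
  simp only [ber] at h1 h2 ⊢
  rw [h1, h2]
  linarith

end IsMetricFamily

namespace IsScatteringFlow

/-- It is a combination, with function coefficients, of covariant derivatives of W. -/
theorem driftLaplacian_mem (h : IsScatteringFlow U G X) (hf : SmoothOn (cyl U) f) (k : ℕ) :
    MemCentralizer U G X (cyl U) k (driftLaplacian G f) := by
  have hG := h.toIsMetricFamily
  refine (MemCentralizer.sub hG subset_rfl ?_ ?_).const_smul hG subset_rfl (1 / 2)
  · exact .sum _ hG subset_rfl fun i _ => .sum _ hG subset_rfl fun j _ =>
      (h.cd2_mem (h.mem (k + 2)) _ _).smul hG subset_rfl (hG.smooth_invMetric i j)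
  · exact (h.mem (k + 1)).cd_along hG subset_rfl (hG.smooth_inverse.apply (smooth_sgrad hf))

/-- The trace kills the commutator with Γ, so it intertwines ∇ and ∂. -/
theorem sd_td (h : IsScatteringFlow U G X)
    (hft : ∀ p ∈ cyl U, td f p = (1 / 2) * trL E (velocity G p)) (hp : p ∈ cyl U) (v : E) :
    sd v (td f) p = (1 / 2) * trL E (cd G v (velocity G) p) := by
  have hW := h.smooth_velocity
  rw [sd, pd_congr h.isOpen hft _ hp]
  simp only [← smul_eq_mul]
  rw [pd_const_smul _ _ (hW.clm (trL E)) hp, pd_clm _ _ hW hp, cd, map_add, map_sub, trL_mul_comm,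
    sub_self, add_zero]

/-- Varying f contributes ½ tr ∇²_{u,v}W and varying the connection −½ df(∇_uW v). Total symmetry
turns the first into the rough Laplacian, and the Codazzi equation with self-adjointness turns the
second into the drift term. -/
theorem td_hess (h : IsScatteringFlow U G X)
    (hft : ∀ p ∈ cyl U, td f p = (1 / 2) * trL E (velocity G p)) (hf : SmoothOn (cyl U) f)
    (hp : p ∈ cyl U)
    (u v : E) : td (hess G f) p u v = G p (driftLaplacian G f p u) v := by
  have hG := h.toIsMetricFamily
  have hs := smooth_sgrad hf
  have hb := (hG.smooth_gam u).apply_const v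
  have hW := h.smooth_velocity
  have h1 : sd u (sd v (td f)) p = (1 / 2) * trL E (cd G u (cd G v (velocity G)) p) := by
    rw [sd, pd_congr hG.isOpen (fun q hq => h.sd_td hft hq v) _ hp]
    simp only [← smul_eq_mul]
    have hc := h.smooth_cd hW v
    rw [pd_const_smul _ _ (hc.clm (trL E)) hp, pd_clm _ _ hc hp, cd.eq_def G u, map_add, map_sub,
      trL_mul_comm, sub_self, add_zero]
  have h2 : td (hess G f) p u v = sd u (sd v (td f)) p
      - (sd (gam G u p v) (td f) p + sgrad f p (td (gam G u) p v)) := by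
    rw [← pd_apply_const _ (hG.smooth_hess hf) u hp,
      ← pd_apply_const _ ((hG.smooth_hess hf).apply_const u) v hp,
      pd_congr hG.isOpen (fun q hq => hG.hess_apply hf hq u v) _ hp,
      pd_sub _ ((hf.pd _).pd _) (hs.apply hb) hp, pd_apply _ hs hb hp, pd_sgrad hf hp,
      pd_apply_const _ (hG.smooth_gam u) v hp, sd, pd_comm _ _ (hf.pd _) hp]
    rw [sd, sd, pd_congr hG.isOpen (fun q hq => pd_comm _ _ hf hq) _ hp]
  have h3 : sgrad f p (cd G u (velocity G) p v) = G p (cd G (ContinuousLinearMap.inverse (G p)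
      (sgrad f p)) (velocity G) p u) v := by
    rw [h.codazzi p hp _ u, h.cd_velocity_selfAdjoint hp, (h.invertible hp).self_apply_inverse]
  have h4 := h.trL_cd2 hp u v
  rw [cd2, map_sub] at h4
  rw [h2, h1, h.sd_td hft hp, h.td_gam hp]
  simp only [driftLaplacian, smul_apply, sub_apply, map_smul, map_sub, smul_eq_mul]
  rw [← h3, ← h4]
  ring

/-- Ric is constant in time, so only the Hessian varies; the term −WH comes from differentiating
g⁻¹. -/
theorem td_berEnd (h : IsScatteringFlow U G X)
    (hft : ∀ p ∈ cyl U, td f p = (1 / 2) * trL E (velocity G p)) (hf : SmoothOn (cyl U) f)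
    (hp : p ∈ cyl U) :
    td (berEnd G f) p = driftLaplacian G f p - velocity G p * berEnd G f p := by
  have hG := h.toIsMetricFamily
  have hH := hG.smooth_berEnd hf
  have hB := hG.smooth_ber hf
  refine hG.end_ext hp fun v w => ?_
  have h1 := pd_congr hG.isOpen (fun q hq => hG.berEnd_spec (f := f) hq v w) (1, 0) hp
  rw [← td, hG.td_pairing hp (hH.apply_const v) (.const hG.isOpen w),
    pd_apply_const _ (hB.apply_const v) w hp, pd_apply_const _ hB v hp, td, td, pd_const, map_zero,
    pd_apply_const _ hH v hp, ← td, ← td] at h1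
  have h2 : td (ber G f) p = td (hess G f) p := by
    have h3 : td (ber G f) p = td (ric G) p + td (hess G f) p :=
      pd_add _ hG.smooth_ric (hG.smooth_hess hf) hp
    rw [h.td_ric hp] at h3
    exact h3.trans (zero_add (td (hess G f) p))
  rw [h2, h.td_hess hft hf hp] at h1
  simp only [sub_apply, map_sub, mul_apply_eq_comp]
  linarith

theorem berEnd_mem (h : IsScatteringFlow U G X)
    (hft : ∀ p ∈ cyl U, td f p = (1 / 2) * trL E (velocity G p)) (hf : SmoothOn (cyl U) f) {k : ℕ}
    (h0 : MemCentralizer U G X (slice0 U) k (berEnd G f)) :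
    MemCentralizer U G X (cyl U) k (berEnd G f) :=
  h.propagate (h.smooth_berEnd hf) (h.driftLaplacian_mem hf k)
    (fun _ hp => h.td_berEnd hft hf hp) h0

/-- The Codazzi equation for `Ric g + ∇ d f` propagates along the flow. -/
theorem berEnd_codazzi (h : IsScatteringFlow U G X)
    (hft : ∀ p ∈ cyl U, td f p = (1 / 2) * trL E (velocity G p)) (hf : SmoothOn (cyl U) f)
    (h0 : ∀ p ∈ slice0 U, ∀ ξ η, cd G ξ (berEnd G f) p η = cd G η (berEnd G f) p ξ)
    (hp : p ∈ cyl U) (ξ η : E) : cd G ξ (berEnd G f) p η = cd G η (berEnd G f) p ξ := by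
  have hG := h.toIsMetricFamily
  have hs := smooth_sgrad hf
  have hric := hG.smooth_ric
  have hp0 : (0, p.2) ∈ cyl U := ⟨mem_univ _, hp.2⟩
  rw [← sub_eq_zero]
  refine hG.ext_of hp fun ζ => ?_
  rw [map_zero, zero_apply, hG.berEnd_codazzi_defect hf hp]
  set D : ℝ × E → ℝ := fun p => (sd ξ (ric G) p η ζ - ric G p η (gam G ξ p ζ))
        - (sd η (ric G) p ξ ζ - ric G p ξ (gam G η p ζ)) - sgrad f p (curv G ξ η p ζ) with hD
  have hs1 : ∀ a b, SmoothOn (cyl U) (fun q => sd a (ric G) q b ζ) := fun a b =>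
    ((hric.pd _).apply_const b).apply_const ζ
  have hg := fun a => (hG.smooth_gam a).apply_const ζ
  have hs2 : ∀ a b, SmoothOn (cyl U) (fun q => ric G q b (gam G a q ζ)) := fun a b =>
    (hric.apply_const b).apply (hg a)
  have hc := (hG.smooth_curv ξ η).apply_const ζ
  have hs3 : SmoothOn (cyl U) (fun q => sgrad f q (curv G ξ η q ζ)) := hs.apply hc
  have hDs : SmoothOn (cyl U) D := (((hs1 ξ η).sub (hs2 ξ η)).sub ((hs1 η ξ).sub (hs2 η ξ))).sub hs3
  have hD0 : D (0, p.2) = 0 := by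
    rw [hD]
    dsimp only
    rw [← hG.berEnd_codazzi_defect hf hp0, h0 (0, p.2) ⟨rfl, hp.2⟩ ξ η, sub_self, map_zero,
      zero_apply]
  change D p = 0
  rw [eq_of_td_eq_zero hDs (fun q hq => ?_) hp, hD0]
  have hr0 : ∀ a, td (sd a (ric G)) q = 0 := fun a => by
    rw [td, sd, pd_comm _ _ hric hq, pd_congr hG.isOpen (fun z hz => h.td_ric hz) _ hq, pd_const]
  have t1 : ∀ a b, td (fun q => sd a (ric G) q b ζ) q = 0 := fun a b => by
    rw [td, pd_apply_const _ ((hric.pd _).apply_const b) ζ hq, pd_apply_const _ (hric.pd _) b hq,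
      ← td, hr0]
    simp
  -- By the Codazzi equation Γ̇(a)ζ = ½ A a, so A carries the whole variation of the Ricci part of
  -- the defect.
  set A := cd G ζ (velocity G) q with hA
  have hAs : ∀ v w, G q (A v) w = G q v (A w) := h.cd_velocity_selfAdjoint hq ζ
  have hAc : ∀ u v, Commute (curv G u v q) A := h.commute_curv hq ((h.mem 1).cd ζ)
  have t2 : ∀ a b, td (fun q => ric G q b (gam G a q ζ)) q = (1 / 2) * ric G q b (A a) :=
    fun a b => by
      rw [td, pd_apply _ (hric.apply_const b) (hg a) hq, pd_apply_const _ hric b hq, ← td,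
        h.td_ric hq, pd_apply_const _ (hG.smooth_gam a) ζ hq, ← td, h.td_gam hq, smul_apply,
        h.codazzi q hq a ζ]
      simp [hA]
  -- Only df varies, giving ½ tr ∇_{R(ξ,η)ζ}W. Two uses of the Codazzi equation and commutation
  -- rewrite this derivative of W as R(ξ,η)A, a skew endomorphism times a commuting self-adjoint
  -- one, hence skew and traceless.
  have t3 : td (fun q => sgrad f q (curv G ξ η q ζ)) q = 0 := by
    rw [td, pd_apply _ hs hc hq, pd_sgrad hf hq, ← td, h.sd_td hft hq,
      pd_apply_const _ (hG.smooth_curv ξ η) ζ hq, ← td, h.td_curv hq]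
    have e1 : cd G (curv G ξ η q ζ) (velocity G) q = curv G ξ η q * A := by
      ext u
      rw [h.codazzi q hq, mul_apply_eq_comp, hA, h.codazzi q hq ζ u]
      exact (congrArg (fun L : E →L[ℝ] E => L ζ)
        (h.commute_curv hq ((h.mem 1).cd u) ξ η).eq).symm
    rw [e1, hG.trL_skew hq fun v w => ?_]
    · simp
    · have e2 : curv G ξ η q (A w) = A (curv G ξ η q w) :=
        congrArg (fun L : E →L[ℝ] E => L w) (hAc ξ η).eq
      rw [mul_apply_eq_comp, mul_apply_eq_comp, hG.curv_skew hq, hAs, e2]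
  rw [td, hD, pd_sub _ (((hs1 ξ η).sub (hs2 ξ η)).sub ((hs1 η ξ).sub (hs2 η ξ))) hs3 hq,
    pd_sub _ ((hs1 ξ η).sub (hs2 ξ η)) ((hs1 η ξ).sub (hs2 η ξ)) hq,
    pd_sub _ (hs1 ξ η) (hs2 ξ η) hq, pd_sub _ (hs1 η ξ) (hs2 η ξ) hq,
    ← td, ← td, ← td, ← td, ← td, t1, t1, t2, t2, t3, hG.ric_symm hq ξ, hG.ric_slide hq hAs hAc]
  ring

end IsScatteringFlow

end BakryEmery

/-! ### Simple spectrum, volume density, and the theorem on one coordinate domain. -/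

section CoordinateDomain

variable {E : Type*} [NormedAddCommGroup E] [NormedSpace ℝ E] [FiniteDimensional ℝ E]
  {U : Set E} {G : ℝ × E → Bil E} {p : ℝ × E}

/-- `L` has `dim E` distinct real eigenvalues. -/
def IsSimpleDiagonalizable (L : E →L[ℝ] E) : Prop :=
  ∃ μ : Fin (Module.finrank ℝ E) → ℝ, Function.Injective μ ∧
    ∀ i, Module.End.HasEigenvalue L.toLinearMap (μ i)

/-- The centralizer of an endomorphism with distinct real eigenvalues is commutative. -/
theorem IsSimpleDiagonalizable.commute {L A B : E →L[ℝ] E} (hL : IsSimpleDiagonalizable L)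
    (hA : Commute L A) (hB : Commute L B) : Commute A B := by
  obtain ⟨μ, hμ, hev⟩ := hL
  choose e he using fun i => (hev i).exists_hasEigenvector
  have hli := Module.End.eigenvectors_linearIndependent' L.toLinearMap μ hμ e he
  let b := basisOfLinearIndependentOfCardEqFinrank' e hli (Fintype.card_fin _)
  have hb : ∀ i, b i = e i := fun i => by simp [b]
  have hLb : ∀ i, L (b i) = μ i • b i := fun i => by
    rw [hb]; exact (he i).apply_eq_smul
  have hLr : ∀ x j, b.repr (L x) j = μ j * b.repr x j := fun x j => by
    have h : (b.coord j).comp L.toLinearMap = μ j • b.coord j := b.ext fun i => by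
      by_cases hij : i = j
      · subst hij; simp [hLb]
      · simp [hLb, hij]
    exact LinearMap.congr_fun h x
  -- Comparing j-th coordinates of L C bᵢ = C L bᵢ gives (μᵢ − μⱼ)cⱼ = 0, so C is diagonal in the
  -- eigenbasis of L.
  have key : ∀ C : E →L[ℝ] E, Commute L C → ∀ i, ∃ c : ℝ, C (b i) = c • b i := by
    intro C hC i
    refine ⟨b.repr (C (b i)) i, ?_⟩
    apply b.repr.injective
    ext j
    by_cases hij : j = i
    · subst hij; simp
    · have h1 : L (C (b i)) = C (L (b i)) := congrArg (fun T : E →L[ℝ] E => T (b i)) hC.eq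
      have h2 := hLr (C (b i)) j
      rw [h1, hLb, map_smul, map_smul, Finsupp.smul_apply, smul_eq_mul] at h2
      have h3 : μ i - μ j ≠ 0 := sub_ne_zero.2 fun h => hij (hμ h).symm
      have h4 : (μ i - μ j) * b.repr (C (b i)) j = 0 := by linarith
      rw [(mul_eq_zero.1 h4).resolve_left h3]
      simp [Ne.symm hij]
  have hAB : (A * B).toLinearMap = (B * A).toLinearMap := b.ext fun i => by
    change A (B (b i)) = B (A (b i))
    obtain ⟨a, ha⟩ := key A hA i
    obtain ⟨c, hc⟩ := key B hB i
    rw [ha, hc, map_smul, map_smul, ha, hc, smul_comm]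
  exact ContinuousLinearMap.coe_injective hAB

section Volume

variable {vol : E → ℝ}

/-- The Gram matrix of the fixed basis. -/
abbrev gram (b : Bil E) : Matrix (Fin (Module.finrank ℝ E)) (Fin (Module.finrank ℝ E)) ℝ :=
  Matrix.of fun i j => b (Module.finBasis ℝ E i) (Module.finBasis ℝ E j)

theorem gram_det_pos {b : Bil E} (hs : ∀ v w, b v w = b w v) (hp : ∀ v, v ≠ 0 → 0 < b v v) :
    0 < (gram b).det := by
  refine (Matrix.PosDef.of_dotProduct_mulVec_pos ?_ fun x hx => ?_).det_pos
  · ext i j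
    simp [hs]
  · have hx' : ∑ i, x i • Module.finBasis ℝ E i ≠ 0 := fun h =>
      hx (funext fun i => Fintype.linearIndependent_iff.1
        (Module.finBasis ℝ E).linearIndependent x h i)
    have h := hp _ hx'
    simp only [map_sum, FunLike.coe_sum, Finset.sum_apply, map_smul, smul_apply, smul_eq_mul,
      Finset.mul_sum] at h
    simp only [dotProduct, Matrix.mulVec, Matrix.of_apply, Finset.mul_sum, star_trivial]
    rw [Finset.sum_comm]
    refine h.trans_eq (Finset.sum_congr rfl fun j _ => Finset.sum_congr rfl fun i _ => ?_)
    ring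

/-- The logarithm of the volume ratio of a family of metrics. -/
def logVol (G : ℝ × E → Bil E) (vol : E → ℝ) (p : ℝ × E) : ℝ :=
  logVolRatio (fun z => G (p.1, z)) vol p.2

namespace IsMetricFamily

theorem gram_det_pos (hG : IsMetricFamily U G) (hp : p ∈ cyl U) : 0 < (gram (G p)).det :=
  ScatteringData.gram_det_pos (hG.symm p hp) (hG.pos p hp)

theorem logVol_eq (hG : IsMetricFamily U G) (hvol : ∀ y ∈ U, vol y ≠ 0) (hp : p ∈ cyl U) :
    logVol G vol p = (1 / 2) * Real.log (gram (G p)).det - Real.log (vol p.2) := by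
  have h := hG.gram_det_pos hp
  change Real.log (Real.sqrt (gram (G p)).det / |vol p.2|) = _
  rw [Real.log_div (Real.sqrt_pos.2 h).ne' (abs_ne_zero.2 (hvol _ hp.2)), Real.log_sqrt h.le,
    Real.log_abs]
  ring

theorem smooth_logVol (hG : IsMetricFamily U G) (hU : IsOpen U) (hvs : ContDiffOn ℝ ∞ vol U)
    (hvol : ∀ y ∈ U, vol y ≠ 0) : SmoothOn (cyl U) (logVol G vol) := by
  have h1 : ContDiffOn ℝ ∞ (fun p => fun i j => G p (Module.finBasis ℝ E i)
      (Module.finBasis ℝ E j)) (cyl U) := by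
    rw [contDiffOn_pi]; intro i
    rw [contDiffOn_pi]; intro j
    exact ((hG.smooth.apply_const _).apply_const _).2
  have h2 : ContDiffOn ℝ ∞ (fun p => (gram (G p)).det) (cyl U) :=
    contDiff_det.comp_contDiffOn h1
  have h3 : SmoothOn (cyl U) (fun p => Real.log (gram (G p)).det) :=
    ⟨hG.isOpen, h2.log fun p hp => (hG.gram_det_pos hp).ne'⟩
  have h4 : SmoothOn (cyl U) (fun p : ℝ × E => Real.log (vol p.2)) :=
    .of_slice hU (hvs.log hvol)
  exact ((h3.const_smul (1 / 2)).sub h4).congr fun p hp => hG.logVol_eq hvol hp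

theorem td_logVol (hG : IsMetricFamily U G) (hU : IsOpen U) (hvs : ContDiffOn ℝ ∞ vol U)
    (hvol : ∀ y ∈ U, vol y ≠ 0) (hp : p ∈ cyl U) :
    td (logVol G vol) p = (1 / 2) * trL E (velocity G p) := by
  have hs : ∀ s, (s, p.2) ∈ cyl U := fun s => ⟨mem_univ _, hp.2⟩
  have h1 := hasDerivAt_time ((hG.smooth_logVol hU hvs hvol).differentiableAt (hs p.1))
  refine h1.unique ?_
  have h2 : (fun s => logVol G vol (s, p.2)) =
      fun s => (1 / 2) * Real.log (gram (G (s, p.2))).det - Real.log (vol p.2) :=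
    funext fun s => hG.logVol_eq hvol (hs s)
  rw [h2]
  have hd := hG.gram_det_pos hp
  -- N is the transpose of the matrix of W, so that the Gram matrix has derivative N times itself;
  -- the trace is unaffected.
  let N : Matrix (Fin (Module.finrank ℝ E)) (Fin (Module.finrank ℝ E)) ℝ :=
    Matrix.of fun i k => coordL k (velocity G p (Module.finBasis ℝ E i))
  have h3 : HasDerivAt (fun s => (gram (G (s, p.2))).det) (N.trace * (gram (G p)).det) p.1 := by
    refine hasDerivAt_det (A := fun s => gram (G (s, p.2))) hd.ne'.isUnit fun i j => ?_
    have h4 := hasDerivAt_time (((hG.smooth.apply_const (Module.finBasis ℝ E i)).apply_const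
      (Module.finBasis ℝ E j)).differentiableAt (hs p.1))
    refine h4.congr_deriv ?_
    rw [td, pd_apply_const _ (hG.smooth.apply_const _) _ hp, pd_apply_const _ hG.smooth _ hp,
      ← td, ← hG.velocity_spec hp]
    conv_lhs => rw [← sum_coordL (velocity G p (Module.finBasis ℝ E i))]
    simp only [map_sum, map_smul, FunLike.coe_sum, Finset.sum_apply, smul_apply, smul_eq_mul]
    rfl
  have h5 := ((h3.log hd.ne').const_mul (1 / 2 : ℝ)).sub_const (Real.log (vol p.2))
  refine h5.congr_deriv ?_
  have h6 : N.trace = trL E (velocity G p) := (trL_eq_sum _).symm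
  rw [h6, mul_div_assoc, div_self hd.ne', mul_one]

end IsMetricFamily

end Volume

/-- The conditions defining `𝔽^K_g` on a coordinate domain. -/
def LocalMemFK (U : Set E) (γ : E → Bil E) (Kc : E → E →L[ℝ] E) (v : E → Bil E) : Prop :=
  ContDiffOn ℝ ∞ v U ∧ ∀ y ∈ U,
    (∀ ξ η, v y ξ η = v y η ξ) ∧
    (∀ ξ η, iterCovDeriv γ (fun z => raise (γ z) (v z)) 1 y ![ξ] η =
      iterCovDeriv γ (fun z => raise (γ z) (v z)) 1 y ![η] ξ) ∧
    (∀ (p : ℕ) (ξ : Fin p → E),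
      Commute (Kc y) (iterCovDeriv γ (fun z => raise (γ z) (v z)) p y ξ) ∧
      ∀ u w, Commute (curvature γ y u w) (iterCovDeriv γ (fun z => raise (γ z) (v z)) p y ξ))

/-- The fields `K` and `R (u, w)`. -/
def centralFields (G : ℝ × E → Bil E) (Kc : E → E →L[ℝ] E) : Option (E × E) → ℝ × E → E →L[ℝ] E
  | none => fun p => Kc p.2
  | some uw => curv G uw.1 uw.2

theorem iterCd_one {F : ℝ × E → E →L[ℝ] E} (hF : SmoothOn (cyl U) F) (hp : p ∈ cyl U) (ξ : E) :
    iterCd G F 1 ![ξ] p = cd G ξ F p := by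
  rw [iterCd_succ (U := U) ![ξ] hF hp]
  simp only [Finset.univ_eq_empty, Finset.sum_empty, sub_zero]
  rfl

/-- The commutation conditions of a variation, as iterated conditions. -/
theorem LocalMemFK.mem {Kc : E → E →L[ℝ] E} {v : ℝ × E → Bil E} {S : Set ℝ}
    (hG : IsMetricFamily U G) (hv : SmoothOn (cyl U) v)
    (h : ∀ t ∈ S, LocalMemFK U (fun z => G (t, z)) Kc (fun z => v (t, z))) (k : ℕ) :
    MemCentralizer U G (centralFields G Kc) (S ×ˢ U) k (fun q => raise (G q) (v q)) := by
  refine memCentralizer_of_iterCd hG (prod_mono (subset_univ S) subset_rfl) (hG.smooth_raise hv)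
    (fun n ξ q hq i => ?_) k
  have h1 := ((h q.1 hq.1).2 q.2 hq.2).2.2 n ξ
  cases i with
  | none => exact h1.1
  | some uw =>
    have h2 := h1.2 uw.1 uw.2
    rw [hG.curvature_eq (p := q) ⟨mem_univ _, hq.2⟩] at h2
    exact h2

theorem LocalMemFK.codazzi {Kc : E → E →L[ℝ] E} {v : ℝ × E → Bil E}
    (hG : IsMetricFamily U G) (hv : SmoothOn (cyl U) v) (hp : p ∈ cyl U)
    (h : LocalMemFK U (fun z => G (p.1, z)) Kc (fun z => v (p.1, z))) (ξ η : E) :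
    cd G ξ (fun q => raise (G q) (v q)) p η = cd G η (fun q => raise (G q) (v q)) p ξ := by
  rw [← iterCd_one (hG.smooth_raise hv) hp, ← iterCd_one (hG.smooth_raise hv) hp]
  exact (h.2 p.2 hp.2).2.1 ξ η

theorem IsMetricFamily.isScatteringFlow (hG : IsMetricFamily U G) {Kc : E → E →L[ℝ] E}
    (hK : U ⊆ closure {y ∈ U | IsSimpleDiagonalizable (Kc y)})
    (hvar : ∀ t, LocalMemFK U (fun z => G (t, z)) Kc (fun z => deriv (fun s => G (s, z)) t)) :
    IsScatteringFlow U G (centralFields G Kc) := by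
  have hd : EqOn (fun q : ℝ × E => deriv (fun s => G (s, q.2)) q.1) (td G) (cyl U) := fun q hq =>
    (hasDerivAt_time (hG.smooth.differentiableAt hq)).deriv
  have hv : SmoothOn (cyl U) (fun q : ℝ × E => deriv (fun s => G (s, q.2)) q.1) :=
    (hG.smooth.pd _).congr hd
  have hW : EqOn (velocity G) (fun q => raise (G q) (deriv (fun s => G (s, q.2)) q.1)) (cyl U) :=
    fun q hq => by rw [velocity, ← hd hq]
  have hmem : ∀ k, MemCentralizer U G (centralFields G Kc) (cyl U) k (velocity G) := fun k =>
    (LocalMemFK.mem hG hv (fun t _ => hvar t) k).congr hG subset_rfl hW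
  have hcod : ∀ p ∈ cyl U, ∀ ξ η, cd G ξ (velocity G) p η = cd G η (velocity G) p ξ :=
    fun p hp ξ η => by
      rw [hG.cd_eqOn hW ξ hp, hG.cd_eqOn hW η hp]
      exact LocalMemFK.codazzi hG hv hp (hvar p.1) ξ η
  refine ⟨hG, hcod, hmem, fun i p hp => ?_, fun u v => ⟨some (u, v), fun _ _ => rfl⟩, ?_⟩
  · cases i with
    | none => rfl
    | some uw =>
      exact eq_of_td_eq_zero (hG.smooth_curv uw.1 uw.2) (fun q hq => hG.td_curv hcod hq
        (fun u v => (hmem 0).commute hq (some (u, v))) uw.1 uw.2) hp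
  -- Where eigenvalues of K collide its pointwise centralizer need not be commutative; here the
  -- commutator of two smooth fields vanishes on a dense set, hence everywhere by continuity.
  · intro A B hA hB p hp
    have hc : ContinuousOn (fun z => A (p.1, z) * B (p.1, z) - B (p.1, z) * A (p.1, z)) U :=
      (((hA.smooth.mul hB.smooth).sub (hB.smooth.mul hA.smooth)).slice p.1).continuousOn
    have h1 := ((hc p.2 hp.2).mono (fun y hy => hy.1)).mem_closure (hK hp.2) (t := {0})
      fun y hy => sub_eq_zero.2 (hy.2.commute (hA.commute (p := (p.1, y)) ⟨mem_univ _, hy.1⟩ none)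
        (hB.commute (p := (p.1, y)) ⟨mem_univ _, hy.1⟩ none)).eq
    rw [closure_singleton, mem_singleton_iff, sub_eq_zero] at h1
    exact h1

theorem bakryEmeryRicci_slice (vol : E → ℝ) (t : ℝ) :
    bakryEmeryRicci (fun z => G (t, z)) vol = fun z => ber G (logVol G vol) (t, z) := rfl

/-- Invariance of the scattering condition on a coordinate domain. -/
theorem localMemFK_bakryEmeryRicci (hU : IsOpen U) (hG : IsMetricFamily U G)
    {Kc : E → E →L[ℝ] E} (hK : U ⊆ closure {y ∈ U | IsSimpleDiagonalizable (Kc y)})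
    {vol : E → ℝ} (hvs : ContDiffOn ℝ ∞ vol U) (hvol : ∀ y ∈ U, vol y ≠ 0)
    (hvar : ∀ t, LocalMemFK U (fun z => G (t, z)) Kc (fun z => deriv (fun s => G (s, z)) t))
    (h0 : LocalMemFK U (fun z => G (0, z)) Kc (bakryEmeryRicci (fun z => G (0, z)) vol)) (t : ℝ) :
    LocalMemFK U (fun z => G (t, z)) Kc (bakryEmeryRicci (fun z => G (t, z)) vol) := by
  rw [bakryEmeryRicci_slice] at h0 ⊢
  have h := hG.isScatteringFlow hK hvar
  have hf := hG.smooth_logVol hU hvs hvol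
  have hft := fun p hp => hG.td_logVol (p := p) hU hvs hvol hp
  have hB := hG.smooth_ber hf
  have hmem : ∀ k, MemCentralizer U G (centralFields G Kc) (cyl U) k (berEnd G (logVol G vol)) :=
    -- Taking S = {0} imposes the commutation conditions on the initial slice only, while the fields
    -- live on the whole cylinder.
    fun k => h.berEnd_mem hft hf (LocalMemFK.mem hG hB (S := {0})
      (fun s hs => by obtain rfl : s = 0 := hs; exact h0) k)
  have hcod : ∀ p ∈ cyl U, ∀ ξ η, cd G ξ (berEnd G (logVol G vol)) p η =
      cd G η (berEnd G (logVol G vol)) p ξ := fun p hp =>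
    h.berEnd_codazzi hft hf (fun q hq ξ η => LocalMemFK.codazzi hG hB ⟨mem_univ _, hq.2⟩
      (by obtain h1 : q.1 = 0 := hq.1; rw [h1]; exact h0) ξ η) hp
  refine ⟨hB.slice t, fun y hy => ?_⟩
  have hp : (t, y) ∈ cyl U := ⟨mem_univ _, hy⟩
  refine ⟨hG.ber_symm hf hp, fun ξ η => ?_, fun n ξ => ?_⟩
  · have h1 := hcod (t, y) hp ξ η
    rw [← iterCd_one (hG.smooth_berEnd hf) hp, ← iterCd_one (hG.smooth_berEnd hf) hp] at h1
    exact h1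
  · have h1 := MemCentralizer.iterCd hG subset_rfl hmem n 0 ξ
    refine ⟨h1.commute hp none, fun u w => ?_⟩
    have h2 := h1.commute hp (some (u, w))
    change Commute (curv G u w (t, y)) _ at h2
    rw [← hG.curvature_eq hp] at h2
    exact h2

end CoordinateDomain

/-! ### From the manifold to coordinate expressions. -/

section Manifold

variable {E : Type*} [NormedAddCommGroup E] [NormedSpace ℝ E] [FiniteDimensional ℝ E]
  {X : Type*} [TopologicalSpace X] [ChartedSpace E X] [IsManifold 𝓘(ℝ, E) ∞ X]

theorem isOpen_coordDomain (c : X) : IsOpen (coordDomain E c) := isOpen_extChartAt_target c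

theorem pt_mem_source (c : X) {y : E} (hy : y ∈ coordDomain E c) :
    pt c y ∈ (chartAt E c).source := by
  have := (extChartAt 𝓘(ℝ, E) c).map_target hy
  rwa [extChartAt_source] at this

theorem pt_mem_baseSet (c : X) {y : E} (hy : y ∈ coordDomain E c) :
    pt c y ∈ (trivializationAt E (TangentSpace 𝓘(ℝ, E)) c).baseSet := by
  rw [TangentBundle.trivializationAt_baseSet]
  exact pt_mem_source c hy

theorem coframe_frame (c : X) {y : E} (hy : y ∈ coordDomain E c) (v : E) :
    coframe c y (frame c y v) = v :=
  (trivializationAt E (TangentSpace 𝓘(ℝ, E)) c).continuousLinearMapAt_symmL (pt_mem_baseSet c hy) v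

theorem frame_coframe (c : X) {y : E} (hy : y ∈ coordDomain E c) (v : T E (pt c y)) :
    frame c y (coframe c y v) = v :=
  (trivializationAt E (TangentSpace 𝓘(ℝ, E)) c).symmL_continuousLinearMapAt (pt_mem_baseSet c hy) v

/-- The coordinate frame as a linear equivalence. -/
def frameEquiv (c : X) {y : E} (hy : y ∈ coordDomain E c) : E ≃ₗ[ℝ] T E (pt c y) :=
  { (frame c y).toLinearMap with
    invFun := coframe c y
    left_inv := coframe_frame c hy
    right_inv := frame_coframe c hy }

/-- In the tangent trivialization at c this vector field is the constant u. -/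
theorem contMDiffOn_frame (c : X) (u : E) :
    ContMDiffOn 𝓘(ℝ, E) (𝓘(ℝ, E).prod 𝓘(ℝ, E)) ∞
      (fun y : E => Bundle.TotalSpace.mk' E (E := fun x : X => T E x) (pt c y) (frame c y u))
      (coordDomain E c) := by
  rw [(trivializationAt E (TangentSpace 𝓘(ℝ, E)) c).contMDiffOn_iff]
  · refine ⟨contMDiffOn_extChartAt_symm c, contMDiffOn_const (c := u) |>.congr fun y hy => ?_⟩
    have h := coframe_frame c hy u
    rwa [coframe, Bundle.Trivialization.continuousLinearMapAt_apply,
      Bundle.Trivialization.linearMapAt_apply, if_pos (pt_mem_baseSet c hy)] at h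
  · intro y hy
    rw [Bundle.Trivialization.mem_source]
    exact pt_mem_baseSet c hy

/-- The coordinate expression of a family of metrics. -/
def familyExpr (g : ℝ → Metric E X) (c : X) (p : ℝ × E) : Bil E := metricExpr (g p.1) c p.2

theorem smoothOn_familyExpr {g : ℝ → Metric E X} (hg : IsSmoothFamily g) (c : X) :
    SmoothOn (cyl (coordDomain E c)) (familyExpr g c) := by
  refine ⟨isOpen_univ.prod (isOpen_coordDomain c), ?_⟩
  rw [contDiffOn_clm_apply]; intro u
  rw [contDiffOn_clm_apply]; intro v
  have h1 : ContMDiffOn 𝓘(ℝ, ℝ × E) 𝓘(ℝ, E) ∞ (fun p : ℝ × E => pt c p.2)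
      (cyl (coordDomain E c)) :=
    (contMDiffOn_extChartAt_symm c).comp contDiff_snd.contMDiff.contMDiffOn fun p hp => hp.2
  have h2 : ContMDiffOn 𝓘(ℝ, ℝ × E) (𝓘(ℝ, ℝ).prod 𝓘(ℝ, E)) ∞ (fun p : ℝ × E => (p.1, pt c p.2))
      (cyl (coordDomain E c)) := contDiff_fst.contMDiff.contMDiffOn.prodMk h1
  have h3 := hg.comp_contMDiffOn h2
  have hf : ∀ w : E, ContMDiffOn 𝓘(ℝ, ℝ × E) (𝓘(ℝ, E).prod 𝓘(ℝ, E)) ∞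
      (fun p : ℝ × E => Bundle.TotalSpace.mk' E (E := fun x : X => T E x) (pt c p.2)
        (frame c p.2 w)) (cyl (coordDomain E c)) := fun w =>
    (contMDiffOn_frame c w).comp contDiff_snd.contMDiff.contMDiffOn fun p hp => hp.2
  intro p hp
  have h4 : ContMDiffWithinAt 𝓘(ℝ, ℝ × E) (𝓘(ℝ, E).prod 𝓘(ℝ)) ∞
      (fun p : ℝ × E => Bundle.TotalSpace.mk' ℝ (E := Bundle.Trivial X ℝ) (pt c p.2)
        ((g p.1).inner (pt c p.2) (frame c p.2 u) (frame c p.2 v))) (cyl (coordDomain E c)) p := by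
    apply ContMDiffWithinAt.clm_bundle_apply₂ (F₁ := E) (F₂ := E)
    · exact h3 p hp
    · exact hf u p hp
    · exact hf v p hp
  simp only [Bundle.contMDiffWithinAt_totalSpace] at h4
  exact h4.2.contDiffWithinAt

theorem isMetricFamily_familyExpr {g : ℝ → Metric E X} (hg : IsSmoothFamily g) (c : X) :
    IsMetricFamily (coordDomain E c) (familyExpr g c) where
  smooth := smoothOn_familyExpr hg c
  symm p _ _ _ := (g p.1).symm _ _ _
  pos p hp _ hξ := (g p.1).pos _ _ fun h => hξ ((frameEquiv c hp.2).map_eq_zero_iff.1 h)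

/-- The frame carries the fixed basis to a basis of the tangent space, where a nonzero form of top
degree cannot vanish. -/
theorem volExpr_ne_zero (Ω : VolumeForm E X) (c : X) {y : E} (hy : y ∈ coordDomain E c) :
    volExpr Ω c y ≠ 0 :=
  ((Ω.form (pt c y)).map_basis_ne_zero_iff ((Module.finBasis ℝ E).map (frameEquiv c hy))).2
    (Ω.ne_zero _)

theorem isSimpleDiagonalizable_endExpr {K : EndField E X} (c : X) {y : E}
    (hy : y ∈ coordDomain E c) (h : HasDistinctRealEigenvalues K (pt c y)) :
    IsSimpleDiagonalizable (endExpr K c y) := by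
  obtain ⟨μ, hμ, hev⟩ := h
  refine ⟨μ, hμ, fun i => ?_⟩
  obtain ⟨v, hv⟩ := (hev i).exists_hasEigenvector
  refine Module.End.hasEigenvalue_of_hasEigenvector (x := coframe c y v)
    ⟨Module.End.mem_eigenspace_iff.2 ?_, fun h0 => hv.2 ?_⟩
  · have h1 : K (pt c y) v = μ i • v := hv.apply_eq_smul
    change coframe c y (K (pt c y) (frame c y (coframe c y v))) = _
    rw [frame_coframe c hy, h1, map_smul]
  · rw [← frame_coframe c hy v, h0, map_zero]

/-- A neighbourhood in the chart domain pulls back to one in X, which meets the dense set;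
conjugation by the frame preserves eigenvalues. -/
theorem subset_closure_isSimpleDiagonalizable {K : EndField E X}
    (hK : Dense {x : X | HasDistinctRealEigenvalues K x}) (c : X) :
    coordDomain E c ⊆ closure {y ∈ coordDomain E c | IsSimpleDiagonalizable (endExpr K c y)} := by
  intro y hy
  rw [mem_closure_iff_nhds]
  intro N hN
  have h1 : extChartAt 𝓘(ℝ, E) c ⁻¹' (N ∩ coordDomain E c) ∩ (extChartAt 𝓘(ℝ, E) c).source ∈
      nhds (pt c y) := by
    have hs := extChartAt_source_mem_nhds' (I := 𝓘(ℝ, E)) ((extChartAt 𝓘(ℝ, E) c).map_target hy)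
    have hc := continuousAt_extChartAt' (I := 𝓘(ℝ, E)) ((extChartAt 𝓘(ℝ, E) c).map_target hy)
    refine Filter.inter_mem (hc ?_) hs
    rw [(extChartAt 𝓘(ℝ, E) c).right_inv hy]
    exact Filter.inter_mem hN ((isOpen_coordDomain c).mem_nhds hy)
  obtain ⟨x, hxK, hx⟩ := hK.inter_nhds_nonempty h1
  refine ⟨extChartAt 𝓘(ℝ, E) c x, hx.1.1, hx.1.2, isSimpleDiagonalizable_endExpr c hx.1.2 ?_⟩
  rw [pt, (extChartAt 𝓘(ℝ, E) c).left_inv hx.2]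
  exact hxK

end Manifold

end ScatteringData

end

theorem mainTheorem4
    {E : Type*} [NormedAddCommGroup E] [NormedSpace ℝ E] [FiniteDimensional ℝ E]
    {X : Type*} [TopologicalSpace X] [ChartedSpace E X] [IsManifold 𝓘(ℝ, E) ∞ X]
    (Ω : ScatteringData.VolumeForm E X)
    (K : ScatteringData.EndField E X) (hK : K.IsSmooth)
    (hKdistinct : Dense {x : X | ScatteringData.HasDistinctRealEigenvalues K x})
    (g : ℝ → ScatteringData.Metric E X) (hg : ScatteringData.IsSmoothFamily g)
    (hvar : ∀ t : ℝ, ScatteringData.MemFK (g t) K (ScatteringData.variationExpr g t))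
    (h0 : g 0 ∈ ScatteringData.scatteringData Ω K) :
    ∀ t : ℝ, g t ∈ ScatteringData.scatteringData Ω K := by
  intro t c
  exact ScatteringData.localMemFK_bakryEmeryRicci (ScatteringData.isOpen_coordDomain c)
    (ScatteringData.isMetricFamily_familyExpr hg c)
    (ScatteringData.subset_closure_isSimpleDiagonalizable hKdistinct c) (Ω.smooth c)
    (fun _ hy => ScatteringData.volExpr_ne_zero Ω c hy) (fun s => hvar s c) (h0 c) t
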